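/- An \emph{ai-semiring} is an algebra $(S,+,\cdot)$ with two associative binary operations such that $+$ is commutative and idempotent ($x+x=x$) and $\cdot$ distributes over $+$ on both sides; $(S,\cdot)$ is its multiplicative reduct. A semigroup is a \emph{block-group} if, for all its elements $e,f$, each of the conditions $ef=e^2=e\ \&\ fe=f^2=f$ and $ef=f^2=f\ \&\ fe=e^2=e$ implies $e=f$. A \emph{subgroup} of a semigroup is a subsemigroup that is a group under the restricted multiplication. An \emph{identity} is a formal equality $s=t$ of two terms built from variables $x_0,x_1,x_2,\dots$ by means of $+$ and $\cdot$; it holds in an ai-semiring if $s$ and $t$ take equal values under every substitution of elements for the variables. A \emph{finite identity basis} of an ai-semiring $\mathcal S$ is a finite set $\Sigma$ of identities holding in $\mathcal S$ such that every identity of $\mathcal S$ holds in every ai-semiring satisfying $\Sigma$. Let $\mathcal B_2^1$ be the ai-semiring formed by the six matrices \[ \begin{pmatrix}0&0\\0&0\end{pmatrix},\ \begin{pmatrix}1&0\\0&1\end{pmatrix},\ \begin{pmatrix}0&1\\0&0\end{pmatrix},\ \begin{pmatrix}0&0\\1&0\end{pmatrix},\ \begin{pmatrix}1&0\\0&0\end{pmatrix},\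 \begin{pmatrix}0&0\\0&1\end{pmatrix} \] with the usual matrix product as multiplication and the entry-wise (Hadamard) product as addition. \textbf{Theorem.} Let $\mathcal S=(S,+,\cdot)$ be a finite ai-semiring whose multiplicative reduct is a block-group all of whose subgroups are solvable. If all identities of $\mathcal S$ hold in $\mathcal B_2^1$, then $\mathcal S$ has no finite identity basis. -/

import Mathlib

universe u

/-- An additively idempotent semiring: an algebra with two associative binary operations `+`, `*`
such that `*` distributes over `+` on both sides and `+` is commutative and idempotent.
No neutral or zero elements are required. -/
class AISemiring (S : Type u) extends AddCommSemigroup S, Semigroup S, Distrib S where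
  add_idem : ∀ a : S, a + a = a

/-- Terms of type `(2,2)` over the countably infinite set of variables `x₀, x₁, x₂, …`. -/
inductive SemiringTerm : Type
  | var : ℕ → SemiringTerm
  | add : SemiringTerm → SemiringTerm → SemiringTerm
  | mul : SemiringTerm → SemiringTerm → SemiringTerm

/-- The value of a term under a substitution of elements of `S` for the variables. -/
def SemiringTerm.eval {S : Type u} [Add S] [Mul S] (τ : ℕ → S) : SemiringTerm → S
  | .var i => τ i
  | .add s t => s.eval τ + t.eval τ
  | .mul s t => s.eval τ * t.eval τ

/-- An identity `lhs = rhs` between terms. -/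
structure SemiringIdentity : Type where
  lhs : SemiringTerm
  rhs : SemiringTerm

/-- The identity `p` holds in `S`. -/
def SemiringIdentity.HoldsIn (p : SemiringIdentity) (S : Type u) [Add S] [Mul S] : Prop :=
  ∀ τ : ℕ → S, p.lhs.eval τ = p.rhs.eval τ

/-- The set of all identities of `S`. -/
def identitiesOf (S : Type u) [Add S] [Mul S] : Set SemiringIdentity :=
  {p | p.HoldsIn S}

/-- `p` is a consequence of `B` (within ai-semirings): every ai-semiring satisfying all identities
in `B` satisfies `p`. It is enough to look at ai-semirings in `Type`, because the relatively free
ai-semiring on countably many generators defined by `B` is one of them. -/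
def SemiringIdentity.FollowsFrom (p : SemiringIdentity) (B : Set SemiringIdentity) : Prop :=
  ∀ (T : Type) [AISemiring T], (∀ b ∈ B, b.HoldsIn T) → p.HoldsIn T

/-- `B` is an identity basis of `S`: it consists of identities of `S`, and all identities of `S`
follow from it. The laws of ai-semirings are understood to be available for free; as there are only
finitely many of them and they hold in `S`, the existence of a finite basis does not depend on
this convention. -/
def IsIdentityBasis (B : Set SemiringIdentity) (S : Type u) [AISemiring S] : Prop :=
  B ⊆ identitiesOf S ∧ ∀ p ∈ identitiesOf S, p.FollowsFrom B

/-- `S` admits a finite identity basis. -/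
def HasFiniteIdentityBasis (S : Type u) [AISemiring S] : Prop :=
  ∃ B : Set SemiringIdentity, B.Finite ∧ IsIdentityBasis B S

/-- A block-group: a semigroup satisfying the implications
`ef = e² = e & fe = f² = f → e = f` and `ef = f² = f & fe = e² = e → e = f`. -/
def IsBlockGroup (S : Type u) [Semigroup S] : Prop :=
  (∀ e f : S, e * f = e → e * e = e → f * e = f → f * f = f → e = f) ∧
  (∀ e f : S, e * f = f → f * f = f → f * e = e → e * e = e → e = f)

/-- Every subgroup of the semigroup `S`, that is, every subsemigroup of `S` which is a group under
the multiplication of `S`, is solvable. -/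
def HasSolvableSubgroups (S : Type u) [Semigroup S] : Prop :=
  ∀ (H : Subsemigroup S) (G : Type u) [Group G], Nonempty (G ≃* H) → Group.IsSolvable G

/-- The six zero-one `2 × 2` matrices forming the Brandt monoid. -/
def brandtMatrices : Finset (Matrix (Fin 2) (Fin 2) ℕ) :=
  {!![0, 0; 0, 0], !![1, 0; 0, 1], !![0, 1; 0, 0], !![0, 0; 1, 0], !![1, 0; 0, 0], !![0, 0; 0, 1]}

/-- The carrier of the 6-element Brandt monoid. -/
def BrandtMonoid : Type := {A : Matrix (Fin 2) (Fin 2) ℕ // A ∈ brandtMatrices}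

namespace BrandtMonoid

theorem mul_mem : ∀ A ∈ brandtMatrices, ∀ B ∈ brandtMatrices, A * B ∈ brandtMatrices := by
  decide

theorem hadamard_mem :
    ∀ A ∈ brandtMatrices, ∀ B ∈ brandtMatrices, Matrix.hadamard A B ∈ brandtMatrices := by
  decide

theorem mul_hadamard : ∀ A ∈ brandtMatrices, ∀ B ∈ brandtMatrices, ∀ C ∈ brandtMatrices,
    A * Matrix.hadamard B C = Matrix.hadamard (A * B) (A * C) := by
  decide

theorem hadamard_mul : ∀ A ∈ brandtMatrices, ∀ B ∈ brandtMatrices, ∀ C ∈ brandtMatrices,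
    Matrix.hadamard A B * C = Matrix.hadamard (A * C) (B * C) := by
  decide

theorem hadamard_self : ∀ A ∈ brandtMatrices, Matrix.hadamard A A = A := by
  decide

/-- The ai-semiring on the 6-element Brandt monoid: multiplication is the usual matrix product,
addition is the Hadamard (entry-wise) product. -/
instance : AISemiring BrandtMonoid where
  add A B := ⟨Matrix.hadamard A.1 B.1, hadamard_mem _ A.2 _ B.2⟩
  mul A B := ⟨A.1 * B.1, mul_mem _ A.2 _ B.2⟩
  add_assoc A B C := Subtype.ext (Matrix.hadamard_assoc A.1 B.1 C.1)
  add_comm A B := Subtype.ext (Matrix.hadamard_comm A.1 B.1)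
  mul_assoc A B C := Subtype.ext (Matrix.mul_assoc A.1 B.1 C.1)
  left_distrib A B C := Subtype.ext (mul_hadamard _ A.2 _ B.2 _ C.2)
  right_distrib A B C := Subtype.ext (hadamard_mul _ A.2 _ B.2 _ C.2)
  add_idem A := Subtype.ext (hadamard_self _ A.2)

end BrandtMonoid

/-!
The proof exhibits, for every `k`, an identity `w = w * w` of `S` that fails in an ai-semiring
satisfying all identities of `BrandtMonoid` in `k` variables.

The words `w` are nested. A word `W` is a concatenation of `M` arrangements of the same letters, and
nesting substitutes copies of a word in disjoint sets of variables for the letters of `W`. Since `S`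
is finite, the sets of values of the nested words in `S ∪ {1}` become stable: eventually every value
is a value of `W` at values of the same kind. If one of them were not idempotent, a topmost such
value `v` for divisibility would, as regular elements of a block-group compose like arrows of a
groupoid, be a value of `W` at elements of the maximal subgroup around `v`. There `M`-th powers are
trivial, so values of `W` lie in the commutator subgroup, and solvability forces `v` to be the
neutral element of that subgroup.

On the other hand, `W` can be chosen such that equal letters are far apart and no two letters are
close to each other twice. The letters of `w` act on the positions `0, …, |w|` by partial
injections, each letter moving its occurrences one step forward, and `w` acts by `0 ↦ |w|`, which is
not idempotent. These partial injections generate under intersection and composition an ai-semiring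
of partial injections. Any `k` of its members admit enough two-colourings of the positions under
which each of them is either colour-preserving or monochromatic at its sources and at its targets.
Such a colouring maps the members to the identity or to matrix units of `BrandtMonoid`, and there
are enough of them to tell different values of terms in `k` variables apart.
-/

/-! ### Idempotents and divisibility in finite monoids -/

/-- Two-sided divisibility in a monoid, the preorder whose equivalence is Green's relation `𝓙`. -/
def IsFactor {S : Type*} [Monoid S] (x y : S) : Prop :=
  ∃ u w, u * x * w = y

/-- `d` is the idempotent at which the regular element `x` starts, that is, an idempotent
generating the same right ideal as `x`. The terminology is that of the groupoid formed by the
regular elements of a block-group, in which `x` is an arrow from its source to its target. -/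
def IsSource {S : Type*} [Monoid S] (x d : S) : Prop :=
  IsIdempotentElem d ∧ d * x = x ∧ ∃ y, x * y = d

/-- `f` is the idempotent at which the regular element `x` ends, that is, an idempotent
generating the same left ideal as `x`. -/
def IsTarget {S : Type*} [Monoid S] (x f : S) : Prop :=
  IsIdempotentElem f ∧ x * f = x ∧ ∃ y, y * x = f

section Monoid

open MulOpposite

variable {S : Type*} [Monoid S] {a s u w x y z d f : S}

theorem IsFactor.refl (x : S) : IsFactor x x := ⟨1, 1, by simp⟩

theorem IsFactor.trans (hxy : IsFactor x y) (hyz : IsFactor y z) : IsFactor x z := by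
  obtain ⟨u, w, rfl⟩ := hxy
  obtain ⟨p, q, rfl⟩ := hyz
  exact ⟨p * u, w * q, by simp only [mul_assoc]⟩

theorem isFactor_mul_right (x w : S) : IsFactor x (x * w) := ⟨1, w, by simp⟩

theorem isFactor_mul_left (u x : S) : IsFactor x (u * x) := ⟨u, 1, by simp⟩

theorem IsFactor.op (h : IsFactor x y) : IsFactor (op x) (op y) := by
  obtain ⟨u, w, rfl⟩ := h
  exact ⟨MulOpposite.op w, MulOpposite.op u, by simp only [op_mul, mul_assoc]⟩

theorem IsTarget.op (h : IsTarget x f) : IsSource (op x) (op f) :=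
  ⟨congrArg MulOpposite.op h.1, congrArg MulOpposite.op h.2.1,
    h.2.2.imp' MulOpposite.op fun _ hy => congrArg MulOpposite.op hy⟩

theorem isSource_of_mul_mul_eq_self (h : x * y * x = x) : IsSource x (x * y) :=
  ⟨by rw [IsIdempotentElem, ← mul_assoc, h], h, y, rfl⟩

theorem isTarget_of_mul_mul_eq_self (h : x * y * x = x) : IsTarget x (y * x) :=
  ⟨by rw [IsIdempotentElem, mul_assoc, ← mul_assoc x, h], by rw [← mul_assoc, h], y, rfl⟩

theorem IsSource.exists_mul_mul_eq_self (h : IsSource x d) : ∃ y, x * y * x = x := by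
  obtain ⟨-, hdx, y, rfl⟩ := h
  exact ⟨y, hdx⟩

theorem IsSource.exists_isTarget (h : IsSource x d) : ∃ f, IsTarget x f :=
  let ⟨_, hy⟩ := h.exists_mul_mul_eq_self
  ⟨_, isTarget_of_mul_mul_eq_self hy⟩

theorem pow_mul_mul_pow_eq_self (h : u * s * w = s) (n : ℕ) : u ^ n * s * w ^ n = s := by
  induction n with
  | zero => simp
  | succ n ih =>
    calc u ^ (n + 1) * s * w ^ (n + 1) = u ^ n * (u * s * w) * w ^ n := by
          simp only [pow_succ u, pow_succ' w, mul_assoc]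
      _ = s := by rw [h, ih]

theorem pow_mul_eq_self_of_isIdempotentElem {n : ℕ} (h : u * s * w = s)
    (hu : IsIdempotentElem (u ^ n)) : u ^ n * s = s := by
  have hn := pow_mul_mul_pow_eq_self h n
  calc u ^ n * s = u ^ n * u ^ n * s * w ^ n := by conv_lhs => rw [← hn]; simp only [← mul_assoc]
    _ = s := by rw [hu, hn]

variable [Finite S]

theorem exists_isIdempotentElem_pow (x : S) : ∃ n, IsIdempotentElem (x ^ (n + 1)) := by
  let : TopologicalSpace S := ⊥
  have : DiscreteTopology S := ⟨rfl⟩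
  obtain ⟨_, ⟨n, rfl⟩, hn⟩ := exists_idempotent_in_compact_subsemigroup
    (fun _ => continuous_of_discreteTopology) (Set.range fun n => x ^ (n + 1))
    (Set.range_nonempty _) (Set.toFinite _).isCompact (by
      rintro _ ⟨i, rfl⟩ _ ⟨j, rfl⟩
      exact ⟨i + 1 + j, by rw [← pow_add]; rfl⟩)
  exact ⟨n, hn⟩

variable (S) in
theorem exists_le_forall_isIdempotentElem_pow (c : ℕ) :
    ∃ n, c ≤ n ∧ ∀ x : S, IsIdempotentElem (x ^ n) := by
  have := Fintype.ofFinite S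
  choose n hn using exists_isIdempotentElem_pow (S := S)
  refine ⟨c * ∏ x, (n x + 1), Nat.le_mul_of_pos_right c (Finset.prod_pos fun _ _ => by omega),
    fun x => ?_⟩
  obtain ⟨q, hq⟩ := (Finset.dvd_prod_of_mem (fun x => n x + 1) (Finset.mem_univ x)).mul_left c
  rw [hq, pow_mul]
  exact (hn x).pow q

theorem IsFactor.exists_mul_right_eq (h : IsFactor (s * a) s) : ∃ z, s * a * z = s := by
  obtain ⟨u, w, h⟩ := h
  have h' : u * s * (a * w) = s := by simpa only [mul_assoc] using h
  obtain ⟨n, hn⟩ := exists_isIdempotentElem_pow u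
  have hs := pow_mul_mul_pow_eq_self h' (n + 1)
  rw [pow_mul_eq_self_of_isIdempotentElem h' hn, pow_succ'] at hs
  exact ⟨w * (a * w) ^ n, by simpa only [mul_assoc] using hs⟩

theorem IsFactor.exists_mul_left_eq (h : IsFactor (a * s) s) : ∃ z, z * (a * s) = s := by
  have := Finite.of_equiv S opEquiv
  obtain ⟨z, hz⟩ := h.op.exists_mul_right_eq
  exact ⟨unop z, op_injective hz⟩

theorem exists_mul_mul_eq_self_of_isFactor_repeat (h : IsFactor (a * y * a) a) :
    ∃ q, a * q * a = a := by
  obtain ⟨z, hz⟩ := IsFactor.exists_mul_right_eq (s := a) (a := y * a) (by rwa [← mul_assoc])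
  obtain ⟨n, hn⟩ := exists_isIdempotentElem_pow (a * y)
  have hpow := pow_mul_eq_self_of_isIdempotentElem (by rwa [← mul_assoc] at hz) hn
  exact ⟨y * (a * y) ^ n, by rwa [pow_succ', mul_assoc a y] at hpow⟩

theorem exists_mul_mul_eq_self_of_isFactor (hax : IsFactor a x) (hxa : IsFactor x a)
    (ha : ∃ q, a * q * a = a) : ∃ q, x * q * x = x := by
  obtain ⟨q, hq⟩ := ha
  obtain ⟨p, r, rfl⟩ := hax
  obtain ⟨z, hz⟩ : ∃ z, z * (p * a) = a :=
    IsFactor.exists_mul_left_eq ((isFactor_mul_right _ _).trans hxa)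
  obtain ⟨z', hz'⟩ : ∃ z', a * r * z' = a := by
    refine IsFactor.exists_mul_right_eq (IsFactor.trans ?_ hxa)
    rw [mul_assoc]
    exact isFactor_mul_left _ _
  refine ⟨z' * q * z, ?_⟩
  calc p * a * r * (z' * q * z) * (p * a * r)
      = p * (a * r * z') * q * (z * (p * a)) * r := by simp only [mul_assoc]
    _ = p * (a * q * a) * r := by rw [hz, hz']; simp only [mul_assoc]
    _ = p * a * r := by rw [hq]

end Monoid

/-! ### Regular elements of block-groups -/

/-- How a letter `a` of a product changes the target `p` of the prefix before it into the
target `q` of the prefix after it, as long as the prefixes keep generating the same right ideal: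
an idempotent fixes `p`, and a nonidempotent is an arrow from `p` to `q`. -/
def IsStep {S : Type*} [Monoid S] (a p q : S) : Prop :=
  (IsIdempotentElem a ∧ p * a = p ∧ q = p) ∨
    (¬ IsIdempotentElem a ∧ IsSource a p ∧ IsTarget a q)

namespace IsBlockGroup

open MulOpposite

variable {S : Type*} [Monoid S] {a d e f g s x z z' p q r : S}

theorem op {S : Type*} [Semigroup S] (hb : IsBlockGroup S) : IsBlockGroup Sᵐᵒᵖ :=
  ⟨fun _ _ hfe he hef hf => unop_injective (hb.2 _ _ (congrArg unop hef) (congrArg unop hf)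
      (congrArg unop hfe) (congrArg unop he)),
    fun _ _ hfe hf hef he => unop_injective (hb.1 _ _ (congrArg unop hef) (congrArg unop he)
      (congrArg unop hfe) (congrArg unop hf))⟩

theorem isSource_unique (hb : IsBlockGroup S) (hd : IsSource x d) (he : IsSource x e) :
    d = e := by
  obtain ⟨hdd, hdx, y, rfl⟩ := hd
  obtain ⟨hee, hex, z, rfl⟩ := he
  exact hb.2 _ _ (by rw [← mul_assoc, hdx]) hee (by rw [← mul_assoc, hex]) hdd

theorem isTarget_unique (hb : IsBlockGroup S) (hd : IsTarget x d) (he : IsTarget x e) : d = e :=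
  op_injective (hb.op.isSource_unique hd.op he.op)

theorem idem_absorb_of_mul_right (hb : IsBlockGroup S) (he : IsIdempotentElem e)
    (hf : IsIdempotentElem f) (h : e * f * x = e) : e * f = e ∧ f * e = e := by
  have hk : IsIdempotentElem (f * x * e) := by
    calc f * x * e * (f * x * e) = f * x * (e * f * x) * e := by simp only [mul_assoc]
      _ = f * x * e := by rw [h, mul_assoc (f * x), he]
  have hek : e = f * x * e := by
    refine hb.1 e (f * x * e) ?_ he ?_ hk
    · calc e * (f * x * e) = e * f * x * e := by simp only [mul_assoc]
        _ = e := by rw [h, he]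
    · rw [mul_assoc, he]
  have hfe : f * e = e := by
    calc f * e = f * f * x * e := by conv_lhs => rw [hek]; simp only [← mul_assoc]
      _ = e := by rw [hf, ← hek]
  have hef : e = e * f := by
    refine hb.2 e (e * f) ?_ ?_ ?_ he
    · rw [← mul_assoc, he]
    · rw [mul_assoc, ← mul_assoc f, hfe, ← mul_assoc, he]
    · rw [mul_assoc, hfe, he]
  exact ⟨hef.symm, hfe⟩

theorem idem_absorb_of_mul_left (hb : IsBlockGroup S) (he : IsIdempotentElem e)
    (hf : IsIdempotentElem f) (h : x * (f * e) = e) : e * f = e ∧ f * e = e := by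
  obtain ⟨hfe, hef⟩ := hb.op.idem_absorb_of_mul_right (congrArg MulOpposite.op he)
    (congrArg MulOpposite.op hf) (congrArg MulOpposite.op h)
  exact ⟨op_injective hef, op_injective hfe⟩

theorem target_mul_idem (hb : IsBlockGroup S) (hf : IsTarget s f) (ha : IsIdempotentElem a)
    (hz : s * a * z = s) : f * a = f := by
  obtain ⟨hff, -, y, rfl⟩ := hf
  refine (hb.idem_absorb_of_mul_right (x := z) hff ha ?_).1
  calc y * s * a * z = y * (s * a * z) := by simp only [mul_assoc]
    _ = y * s := by rw [hz]

theorem target_eq_source (hb : IsBlockGroup S) (hf : IsTarget s f) (hg : IsSource a g)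
    (hz : s * a * z = s) (hz' : z' * (s * a) = a) : f = g := by
  obtain ⟨hff, hsf, y, hy⟩ := hf
  obtain ⟨hgg, hga, y', hy'⟩ := hg
  have hfg : f * g * (a * z) = f := by
    calc f * g * (a * z) = f * (g * a) * z := by simp only [mul_assoc]
      _ = y * (s * a * z) := by rw [hga, ← hy]; simp only [mul_assoc]
      _ = f := by rw [hz, hy]
  have hgf : z' * s * (f * g) = g := by
    calc z' * s * (f * g) = z' * (s * f) * g := by simp only [mul_assoc]
      _ = z' * (s * a) * y' := by rw [hsf, ← hy']; simp only [mul_assoc]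
      _ = g := by rw [hz', hy']
  exact (hb.idem_absorb_of_mul_right hff hgg hfg).1.symm.trans
    (hb.idem_absorb_of_mul_left hgg hff hgf).2

theorem isStep_of_isTarget [Finite S] (hb : IsBlockGroup S) (hp : IsTarget s p)
    (hq : IsTarget (s * a) q) (hz : s * a * z = s)
    (ha : ¬ IsIdempotentElem a → IsFactor (s * a) a ∧ ∃ y, a * y * a = a) : IsStep a p q := by
  by_cases hidem : IsIdempotentElem a
  · have hpa := hb.target_mul_idem hp hidem hz
    have hsa : s * a = s := by rw [← hp.2.1, mul_assoc, hpa]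
    exact Or.inl ⟨hidem, hpa, hb.isTarget_unique (hsa ▸ hq) hp⟩
  · obtain ⟨hfac, y, hy⟩ := ha hidem
    obtain ⟨z', hz'⟩ := hfac.exists_mul_left_eq
    obtain ⟨-, har, y', hy'⟩ := isTarget_of_mul_mul_eq_self hy
    have hr : IsTarget (s * a) (y * a) :=
      ⟨(isTarget_of_mul_mul_eq_self hy).1, by rw [mul_assoc, har], y' * z', by
        rw [mul_assoc, hz', hy']⟩
    obtain rfl := hb.isTarget_unique hq hr
    obtain rfl := hb.target_eq_source hp (isSource_of_mul_mul_eq_self hy) hz hz'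
    exact Or.inr ⟨hidem, isSource_of_mul_mul_eq_self hy, isTarget_of_mul_mul_eq_self hy⟩

end IsBlockGroup

/-! ### Values of block words in finite block-groups -/

/-- The product `g 0 * g 1 * ⋯ * g (n - 1)`. -/
def seqProd {S : Type*} [Monoid S] (g : ℕ → S) (n : ℕ) : S := ((List.range n).map g).prod

/-- The sequence `W` starts with `M` blocks of length `N`, each being an arrangement of the
letters `0, …, N - 1`. -/
def IsBlockWord (W : ℕ → ℕ) (M N : ℕ) : Prop :=
  ∀ j < M, Set.BijOn (fun s => W (j * N + s)) (Set.Iio N) (Set.Iio N)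

/-- The values of the word `W 0 ⋯ W (n - 1)` under all substitutions of members of `X` for its
letters. -/
def wordValues {S : Type*} [Monoid S] (W : ℕ → ℕ) (n : ℕ) (X : Set S) : Set S :=
  {x | ∃ a : ℕ → S, (∀ t, a t ∈ X) ∧ seqProd (fun i => a (W i)) n = x}

theorem wordValues_mono {S : Type*} [Monoid S] (W : ℕ → ℕ) (n : ℕ) :
    Monotone (wordValues (S := S) W n) :=
  fun _ _ hXY _ ⟨a, ha, hx⟩ => ⟨a, fun t => hXY (ha t), hx⟩

section SeqProd

variable {S : Type*} [Monoid S] {g : ℕ → S} {s : S} {i j n : ℕ}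

@[simp] theorem seqProd_zero (g : ℕ → S) : seqProd g 0 = 1 := rfl

theorem seqProd_succ (g : ℕ → S) (n : ℕ) : seqProd g (n + 1) = seqProd g n * g n :=
  List.prod_range_succ g n

theorem seqProd_add (g : ℕ → S) (m n : ℕ) :
    seqProd g (m + n) = seqProd g m * seqProd (fun i => g (m + i)) n := by
  induction n with
  | zero => simp
  | succ n ih => rw [← add_assoc, seqProd_succ, ih, seqProd_succ, mul_assoc]

theorem seqProd_eq_prod {A : Type*} [CommMonoid A] (g : ℕ → A) (n : ℕ) :
    seqProd g n = ∏ i ∈ Finset.range n, g i := by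
  induction n with
  | zero => simp
  | succ n ih => rw [seqProd_succ, ih, Finset.prod_range_succ]

theorem map_seqProd {T : Type*} [Monoid T] (φ : S →* T) (g : ℕ → S) (n : ℕ) :
    φ (seqProd g n) = seqProd (fun i => φ (g i)) n := by
  induction n with
  | zero => simp
  | succ n ih => rw [seqProd_succ, seqProd_succ, map_mul, ih]

theorem mul_seqProd_eq_self (n : ℕ) (h : ∀ i < n, s * g i = s) : s * seqProd g n = s := by
  induction n with
  | zero => simp
  | succ n ih => rw [seqProd_succ, ← mul_assoc, ih fun i hi => h i (by omega), h n (by omega)]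

theorem exists_seqProd_mul_eq (g : ℕ → S) (h : i ≤ n) : ∃ z, seqProd g i * z = seqProd g n := by
  obtain ⟨d, rfl⟩ := Nat.exists_eq_add_of_le h
  exact ⟨_, (seqProd_add g i d).symm⟩

theorem isFactor_seqProd (g : ℕ → S) (h : i < n) : IsFactor (g i) (seqProd g n) := by
  obtain ⟨z, hz⟩ := exists_seqProd_mul_eq g (Nat.succ_le_of_lt h)
  exact ⟨seqProd g i, z, by rw [← hz, seqProd_succ]⟩

theorem exists_isFactor_seqProd (g : ℕ → S) (hij : i < j) (hj : j < n) :
    ∃ y, IsFactor (g i * y * g j) (seqProd g n) := by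
  obtain ⟨d, rfl⟩ := Nat.exists_eq_add_of_lt hij
  obtain ⟨z, hz⟩ := exists_seqProd_mul_eq g (Nat.succ_le_of_lt hj)
  refine ⟨seqProd (fun t => g (i + 1 + t)) d, seqProd g i, z, ?_⟩
  rw [← hz, seqProd_succ, Nat.add_right_comm i d 1, seqProd_add g (i + 1) d, seqProd_succ]
  simp only [mul_assoc]

end SeqProd

namespace IsBlockWord

variable {W : ℕ → ℕ} {M N i t : ℕ}

theorem lt (hW : IsBlockWord W M N) (hi : i < M * N) : W i < N := by
  have hN : 0 < N := Nat.pos_of_ne_zero (by rintro rfl; simp at hi)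
  have := (hW (i / N) ((Nat.div_lt_iff_lt_mul hN).2 hi)).mapsTo (x := i % N) (Nat.mod_lt _ hN)
  simpa [Nat.div_add_mod'] using this

theorem exists_index (hW : IsBlockWord W M N) {j : ℕ} (hj : j < M) (ht : t < N) :
    ∃ i, j * N ≤ i ∧ i < (j + 1) * N ∧ W i = t := by
  obtain ⟨s, hs, hst⟩ := (hW j hj).surjOn ht
  exact ⟨j * N + s, Nat.le_add_right _ _, by rw [Nat.succ_mul]; exact Nat.add_lt_add_left hs _, hst⟩

theorem exists_repeat (hW : IsBlockWord W M N) (hM : 2 ≤ M) (ht : t < N) :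
    ∃ i j, i < j ∧ j < M * N ∧ W i = t ∧ W j = t := by
  obtain ⟨i, -, hi, hit⟩ := hW.exists_index (j := 0) (by omega) ht
  obtain ⟨j, hj, hj', hjt⟩ := hW.exists_index (j := 1) (by omega) ht
  exact ⟨i, j, by omega, hj'.trans_le (Nat.mul_le_mul_right N hM), hit, hjt⟩

@[to_additive]
theorem prod_eq {A : Type*} [CommMonoid A] (hW : IsBlockWord W M N) (ψ : ℕ → A) :
    ∏ i ∈ Finset.range (M * N), ψ (W i) = (∏ t ∈ Finset.range N, ψ t) ^ M := by
  induction M with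
  | zero => simp
  | succ M ih =>
    have hlast := hW M M.lt_succ_self
    rw [Nat.succ_mul, Finset.prod_range_add, ih fun j hj => hW j (hj.trans M.lt_succ_self),
      pow_succ]
    congr 1
    refine Finset.prod_nbij (fun s => W (M * N + s)) ?_ ?_ ?_ fun _ _ => rfl
    · simpa [Set.MapsTo] using hlast.mapsTo
    · simpa [Set.InjOn] using hlast.injOn
    · simpa [Set.SurjOn] using hlast.surjOn

end IsBlockWord

section Values

variable {S : Type*} [Monoid S] {W : ℕ → ℕ} {M N n : ℕ} {a g F : ℕ → S} {E : Set S} {e s v z : S}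

theorem IsBlockGroup.idem_mul_letter (hb : IsBlockGroup S) (he : IsIdempotentElem e)
    (hg : ∀ i < n, IsIdempotentElem (g i)) (h : e * seqProd g n * z = e) :
    ∀ i < n, e * g i = e := by
  induction n generalizing z with
  | zero => simp
  | succ n ih =>
    have hinit : ∀ i < n, e * g i = e :=
      ih (z := g n * z) (fun i hi => hg i (by omega)) (by
        rwa [mul_assoc, ← mul_assoc (seqProd g n), ← seqProd_succ, ← mul_assoc])
    intro i hi
    rcases Nat.lt_succ_iff_lt_or_eq.1 hi with hi | rfl
    · exact hinit i hi
    · refine (hb.idem_absorb_of_mul_right (x := z) he (hg i hi) ?_).1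
      rwa [seqProd_succ, ← mul_assoc, mul_seqProd_eq_self i hinit] at h

theorem IsBlockGroup.mul_letter_eq_self [Finite S] (hb : IsBlockGroup S)
    (hg : ∀ i < n, IsIdempotentElem (g i)) (h : s * seqProd g n = s) : ∀ i < n, s * g i = s := by
  obtain ⟨m, hm⟩ := exists_isIdempotentElem_pow (seqProd g n)
  have hpow : s * seqProd g n ^ (m + 1) = s := by
    simpa using pow_mul_mul_pow_eq_self (u := 1) (w := seqProd g n) (by rwa [one_mul]) (m + 1)
  have habsorb := hb.idem_mul_letter (z := seqProd g n ^ m) hm hg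
    (by rw [mul_assoc, ← pow_succ', hm])
  intro i hi
  rw [← hpow, mul_assoc, habsorb i hi]

/-- By the pigeonhole principle two prefixes ending at block boundaries agree, so that their
common value absorbs every letter. -/
theorem IsBlockWord.isIdempotentElem_seqProd [Finite S] (hW : IsBlockWord W M N)
    (hb : IsBlockGroup S) (hcard : Nat.card S ≤ M) (ha : ∀ t < N, IsIdempotentElem (a t)) :
    IsIdempotentElem (seqProd (fun i => a (W i)) (M * N)) := by
  have := Fintype.ofFinite S
  set g : ℕ → S := fun i => a (W i)
  obtain ⟨j, j', hne, heq⟩ := Fintype.exists_ne_map_eq_of_card_lt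
    (fun j : Fin (M + 1) => seqProd g (j * N))
    (by rw [Fintype.card_fin, ← Nat.card_eq_fintype_card]; omega)
  wlog hjj : j < j' generalizing j j'
  · exact this j' j hne.symm heq.symm (lt_of_le_of_ne (not_lt.1 hjj) hne.symm)
  have hblock : (j + 1) * N ≤ j' * N := Nat.mul_le_mul_right N hjj
  have hj'M : (j' : ℕ) * N ≤ M * N := Nat.mul_le_mul_right N (Nat.lt_succ_iff.1 j'.2)
  have hjj' : (j : ℕ) * N ≤ j' * N := Nat.mul_le_mul_right N (le_of_lt hjj)
  set s := seqProd g (j * N)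
  have hloop : s * seqProd (fun i => g (j * N + i)) (j' * N - j * N) = s := by
    rw [← seqProd_add, Nat.add_sub_cancel' hjj', ← heq]
  have habsorb : ∀ i < M * N, s * g i = s := by
    intro i hi
    obtain ⟨l, hl, hl', hlt⟩ := hW.exists_index (j := j) (by omega) (hW.lt hi)
    have := hb.mul_letter_eq_self (fun i hi => ha _ (hW.lt (by omega))) hloop (l - j * N) (by omega)
    rwa [Nat.add_sub_cancel' hl, hlt] at this
  have hvalue : seqProd g (M * N) = s := by
    rw [← Nat.add_sub_cancel' (hjj'.trans hj'M), seqProd_add]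
    exact mul_seqProd_eq_self _ fun i hi => habsorb _ (by omega)
  calc seqProd g (M * N) * seqProd g (M * N) = s * seqProd g (M * N) := by rw [hvalue]
    _ = s := mul_seqProd_eq_self _ habsorb
    _ = seqProd g (M * N) := hvalue.symm

theorem IsBlockGroup.exists_isStep [Finite S] (hb : IsBlockGroup S) (hreg : ∃ y, v * y * v = v)
    (hv : seqProd g n = v)
    (hg : ∀ i < n, ¬ IsIdempotentElem (g i) → IsFactor v (g i) ∧ ∃ y, g i * y * g i = g i) :
    ∃ F : ℕ → S, IsSource v (F 0) ∧ IsTarget v (F n) ∧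
      ∀ i < n, IsStep (g i) (F i) (F (i + 1)) := by
  obtain ⟨y, hy⟩ := hreg
  obtain ⟨hee, hev, -⟩ := isSource_of_mul_mul_eq_self hy
  set e := v * y
  have hsuffix : ∀ i ≤ n, ∃ z, e * seqProd g i * z = v := fun i hi => by
    obtain ⟨z, hz⟩ := exists_seqProd_mul_eq g hi
    exact ⟨z, by rw [mul_assoc, hz, hv, hev]⟩
  have hsource : ∀ i ≤ n, IsSource (e * seqProd g i) e := fun i hi => by
    obtain ⟨z, hz⟩ := hsuffix i hi
    exact ⟨hee, by rw [← mul_assoc, hee], z * y, by rw [← mul_assoc, hz]⟩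
  choose! F hF using fun i hi => (hsource i hi).exists_isTarget
  refine ⟨F, ?_, ?_, fun i hi => ?_⟩
  · have : IsTarget (e * seqProd g 0) e := ⟨hee, by simpa using hee.eq, 1, by simp⟩
    rw [hb.isTarget_unique (hF 0 n.zero_le) this]
    exact isSource_of_mul_mul_eq_self hy
  · rw [← hev, ← hv]
    exact hF n le_rfl
  · have hsucc : e * seqProd g i * g i = e * seqProd g (i + 1) := by rw [seqProd_succ, mul_assoc]
    obtain ⟨-, -, q, hq⟩ := hsource (i + 1) hi
    obtain ⟨z, hz⟩ := hsuffix (i + 1) hi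
    refine hb.isStep_of_isTarget (z := q * (e * seqProd g i)) (hF i hi.le) (hsucc ▸ hF (i + 1) hi)
      ?_ fun hne => ⟨?_, (hg i hi hne).2⟩
    · rw [hsucc, ← mul_assoc, hq, (hsource i hi.le).2.1]
    · rw [hsucc]
      exact IsFactor.trans (hz ▸ isFactor_mul_right _ _) (hg i hi hne).1

/-- Every block contributes the same amount to the number of departures from `F 0` minus the
number of arrivals there, and this number is at most one. -/
theorem IsBlockGroup.isStep_closed (hb : IsBlockGroup S) (hM : 2 ≤ M) (hW : IsBlockWord W M N)
    (hF : ∀ i < M * N, IsStep (a (W i)) (F i) (F (i + 1))) : F (M * N) = F 0 := by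
  classical
  let net : ℕ → ℤ := fun t => if IsIdempotentElem (a t) then 0 else
    (if IsSource (a t) (F 0) then 1 else 0) - (if IsTarget (a t) (F 0) then 1 else 0)
  let here : ℕ → ℤ := fun i => if F i = F 0 then 1 else 0
  have hnet : ∀ i < M * N, here i - here (i + 1) = net (W i) := by
    intro i hi
    rcases hF i hi with ⟨hidem, -, hFi⟩ | ⟨hidem, hsrc, htgt⟩
    · simp only [here, net, hidem, hFi, if_true, sub_self]
    · have hsrc' : IsSource (a (W i)) (F 0) ↔ F i = F 0 :=
        ⟨fun h => hb.isSource_unique hsrc h, fun h => h ▸ hsrc⟩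
      have htgt' : IsTarget (a (W i)) (F 0) ↔ F (i + 1) = F 0 :=
        ⟨fun h => hb.isTarget_unique htgt h, fun h => h ▸ htgt⟩
      simp only [here, net, hidem, hsrc', htgt', if_false]
  have hsum : here 0 - here (M * N) = M * ∑ t ∈ Finset.range N, net t := by
    rw [← nsmul_eq_mul, ← hW.sum_eq, ← Finset.sum_range_sub']
    exact Finset.sum_congr rfl fun i hi => hnet i (Finset.mem_range.1 hi)
  by_contra hne
  have hone : (M : ℤ) ∣ 1 := ⟨_, by simpa [here, hne] using hsum⟩
  have := Int.le_of_dvd one_pos hone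
  omega

end Values

/-- The maximal subgroup at `e`: the arrows from `e` to itself, together forming the group of
units of the monoid of all `x` with `e * x = x = x * e`. It is empty if `e` is not idempotent. -/
def maximalSubgroup {S : Type*} [Monoid S] (e : S) : Subsemigroup S where
  carrier := {x | IsSource x e ∧ IsTarget x e}
  mul_mem' := by
    rintro x y ⟨⟨he, hex, x', hx⟩, -, hxe, x'', hx'⟩ ⟨⟨-, hey, y', hy⟩, -, hye, y'', hy'⟩
    refine ⟨⟨he, by rw [← mul_assoc, hex], y' * x', ?_⟩, he, by rw [mul_assoc, hye], y'' * x'', ?_⟩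
    · rw [mul_assoc, ← mul_assoc y, hy, ← mul_assoc, hxe, hx]
    · rw [mul_assoc, ← mul_assoc x'', hx', hey, hy']

namespace maximalSubgroup

variable {S : Type*} [Monoid S] {e x : S}

theorem exists_mul_eq (hx : x ∈ maximalSubgroup e) : ∃ y ∈ maximalSubgroup e, y * x = e := by
  obtain ⟨⟨he, hex, y, hxy⟩, -, hxe, z, hzx⟩ := hx
  have hleft : e * y * e * x = e := by
    calc e * y * e * x = z * (x * y) * (e * x) := by rw [← hzx]; simp only [mul_assoc]
      _ = e := by rw [hxy, hex, mul_assoc, hex, hzx]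
  have hright : x * (e * y * e) = e := by
    rw [← mul_assoc, ← mul_assoc, hxe, hxy, he]
  exact ⟨e * y * e, ⟨⟨he, by rw [← mul_assoc, ← mul_assoc, he], x, hleft⟩,
    he, by rw [mul_assoc, he], x, hright⟩, hleft⟩

/-- The group structure on a maximal subgroup, with neutral element `e`. -/
noncomputable abbrev group (he : IsIdempotentElem e) : Group (maximalSubgroup e) :=
  letI : One (maximalSubgroup e) := ⟨⟨e, ⟨he, he, e, he⟩, he, he, e, he⟩⟩
  letI : Inv (maximalSubgroup e) := ⟨fun x =>
    ⟨(exists_mul_eq x.2).choose, (exists_mul_eq x.2).choose_spec.1⟩⟩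
  Group.ofLeftAxioms mul_assoc (fun x => Subtype.ext x.2.1.2.1)
    (fun x => Subtype.ext (exists_mul_eq x.2).choose_spec.2)

theorem pow_eq_one (he : IsIdempotentElem e) {M : ℕ} (hM : M ≠ 0)
    (hpow : ∀ x : S, IsIdempotentElem (x ^ M)) (g : maximalSubgroup e) :
    letI := group he
    g ^ M = 1 := by
  let := group he
  obtain ⟨m, rfl⟩ := Nat.exists_eq_succ_of_ne_zero hM
  have hcoe : ∀ n : ℕ, ((g ^ (n + 1) : maximalSubgroup e) : S) = (g : S) ^ (n + 1) := by
    intro n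
    induction n with
    | zero => simp
    | succ n ih => rw [pow_succ, pow_succ _ (n + 1), ← ih]; rfl
  have hidem : IsIdempotentElem (g ^ (m + 1)) := Subtype.ext (by
    rw [MulMemClass.coe_mul, hcoe]
    exact hpow g)
  exact IsIdempotentElem.iff_eq_one.1 hidem

theorem coe_seqProd (he : IsIdempotentElem e) {n : ℕ} {g : ℕ → S} {b : ℕ → maximalSubgroup e}
    (h : ∀ i < n, e * g i = b i) :
    letI := group he
    e * seqProd g n = (seqProd b n : maximalSubgroup e) := by
  let := group he
  induction n with
  | zero => exact mul_one e
  | succ n ih =>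
    have ih := ih fun i hi => h i (by omega)
    rw [seqProd_succ, seqProd_succ, MulMemClass.coe_mul, ← ih, ← h n (by omega), ← mul_assoc,
      ← mul_assoc, ih, (seqProd b n).2.2.2.1]

end maximalSubgroup

/-- A nonidempotent member of `E` which, among the nonidempotent members of `E`, lies as high as
possible in the divisibility order. -/
structure IsTopmost {S : Type*} [Monoid S] (E : Set S) (v : S) : Prop where
  mem : v ∈ E
  not_isIdempotentElem : ¬ IsIdempotentElem v
  isFactor : ∀ a ∈ E, ¬ IsIdempotentElem a → IsFactor a v → IsFactor v a

theorem exists_isTopmost {S : Type*} [Monoid S] [Finite S] {E : Set S} {x : S} (hx : x ∈ E)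
    (hne : ¬ IsIdempotentElem x) : ∃ v, IsTopmost E v := by
  let : Preorder S := { le := IsFactor, le_refl := .refl, le_trans := fun _ _ _ => .trans }
  obtain ⟨v, hv⟩ := (Set.toFinite {a | a ∈ E ∧ ¬ IsIdempotentElem a}).exists_minimal ⟨x, hx, hne⟩
  exact ⟨v, hv.prop.1, hv.prop.2, fun a ha hna h => hv.le_of_le ⟨ha, hna⟩ h⟩

/-- The members of `F` are products of commutators of the subgroup generated by `F`, because each
letter occurs a multiple of the exponent number of times. -/
theorem subset_one_of_subset_wordValues {G : Type*} [Group G] [Group.IsSolvable G] {W : ℕ → ℕ}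
    {M N : ℕ} (hW : IsBlockWord W M N) (hexp : ∀ g : G, g ^ M = 1) {F : Set G}
    (hF : F ⊆ wordValues W (M * N) F) : F ⊆ {1} := by
  set H := Subgroup.closure F
  have hle : H ≤ ⁅H, H⁆ := by
    refine (Subgroup.closure_le _).2 fun x hx => ?_
    obtain ⟨b, hb, rfl⟩ := hF hx
    let b' : ℕ → H := fun t => ⟨b t, Subgroup.subset_closure (hb t)⟩
    have hcomm : seqProd (fun i => b' (W i)) (M * N) ∈ commutator H := by
      rw [← Abelianization.ker_of, MonoidHom.mem_ker, map_seqProd, seqProd_eq_prod,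
        hW.prod_eq fun t => Abelianization.of (b' t), ← Finset.prod_pow]
      refine Finset.prod_eq_one fun t _ => ?_
      rw [← map_pow, show b' t ^ M = 1 from Subtype.ext (hexp (b t)), map_one]
    rw [← Subgroup.map_subtype_commutator]
    exact ⟨_, hcomm, map_seqProd H.subtype _ _⟩
  have hbot : H = ⊥ := by
    by_contra hne
    exact (Group.IsSolvable.commutator_lt_of_ne_bot hne).not_ge hle
  exact (Subgroup.closure_eq_bot_iff).1 hbot

section Topmost

variable {S : Type*} [Monoid S] {W : ℕ → ℕ} {M N : ℕ} {E : Set S} {a v : S}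

theorem IsTopmost.of_isFactor (hv : IsTopmost E v) (ha : a ∈ E) (hna : ¬ IsIdempotentElem a)
    (h : IsFactor a v) : IsTopmost E a :=
  ⟨ha, hna, fun b hb hnb hba => h.trans (hv.isFactor b hb hnb (hba.trans h))⟩

variable [Finite S]

theorem IsTopmost.exists_closed_steps (hv : IsTopmost E v) (hb : IsBlockGroup S) (hM : 2 ≤ M)
    (hcard : Nat.card S ≤ M) (hW : IsBlockWord W M N) (hE : E ⊆ wordValues W (M * N) E) :
    ∃ (a : ℕ → S) (F : ℕ → S), (∀ t, a t ∈ E) ∧ seqProd (fun i => a (W i)) (M * N) = v ∧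
      v ∈ maximalSubgroup (F 0) ∧ ∀ i < M * N, IsStep (a (W i)) (F i) (F (i + 1)) := by
  obtain ⟨a, haE, hav⟩ := hE hv.mem
  have hletter : ∀ t < N, ¬ IsIdempotentElem (a t) →
      IsFactor (a t) v ∧ IsFactor v (a t) ∧ ∃ y, a t * y * a t = a t := by
    intro t ht hne
    obtain ⟨i, j, hij, hj, rfl, hjt⟩ := hW.exists_repeat hM ht
    have hfac : IsFactor (a (W i)) v := hav ▸ isFactor_seqProd (fun i => a (W i)) (hij.trans hj)
    have htop := hv.isFactor _ (haE _) hne hfac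
    obtain ⟨y, hy⟩ := exists_isFactor_seqProd (fun i => a (W i)) hij hj
    rw [hjt, hav] at hy
    exact ⟨hfac, htop, exists_mul_mul_eq_self_of_isFactor_repeat (hy.trans htop)⟩
  have hreg : ∃ y, v * y * v = v := by
    obtain ⟨t, ht, hne⟩ : ∃ t < N, ¬ IsIdempotentElem (a t) := by
      by_contra! hidem
      exact hv.not_isIdempotentElem (hav ▸ hW.isIdempotentElem_seqProd hb hcard hidem)
    obtain ⟨hav, hva, hat⟩ := hletter t ht hne
    exact exists_mul_mul_eq_self_of_isFactor hav hva hat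
  obtain ⟨F, hsrc, htgt, hF⟩ := hb.exists_isStep hreg hav
    fun i hi hne => (hletter _ (hW.lt hi) hne).2
  exact ⟨a, F, haE, hav, ⟨hsrc, hb.isStep_closed hM hW hF ▸ htgt⟩, hF⟩

theorem IsTopmost.exists_letters (hv : IsTopmost E v) (hb : IsBlockGroup S) (hM : 2 ≤ M)
    (hcard : Nat.card S ≤ M) (hW : IsBlockWord W M N) (hE : E ⊆ wordValues W (M * N) E) :
    ∃ e, v ∈ maximalSubgroup e ∧ ∃ a : ℕ → S, (∀ t, a t ∈ E) ∧
      seqProd (fun i => a (W i)) (M * N) = v ∧ ∀ t < N, e * a t = e ∨ a t ∈ maximalSubgroup e := by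
  obtain ⟨a, F, haE, hav, hvF, hF⟩ := hv.exists_closed_steps hb hM hcard hW hE
  have hloop : ∀ i < M * N, F (i + 1) = F i := by
    intro i hi
    rcases hF i hi with ⟨-, -, hFi⟩ | ⟨hne, hsrc, htgt⟩
    · exact hFi
    · have htop := hv.of_isFactor (haE _) hne
        (hav ▸ isFactor_seqProd (fun i => a (W i)) hi)
      obtain ⟨_, F', -, -, ⟨hsrc', htgt'⟩, -⟩ := htop.exists_closed_steps hb hM hcard hW hE
      rw [hb.isTarget_unique htgt htgt', hb.isSource_unique hsrc hsrc']
  have hconst : ∀ i ≤ M * N, F i = F 0 := by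
    intro i
    induction i with
    | zero => exact fun _ => rfl
    | succ i ih => exact fun hi => (hloop i hi).trans (ih (by omega))
  refine ⟨F 0, hvF, a, haE, hav, fun t ht => ?_⟩
  obtain ⟨i, j, hij, hj, rfl, -⟩ := hW.exists_repeat hM ht
  have hstep := hF i (hij.trans hj)
  rw [hconst _ (hij.trans hj), hconst _ (hij.le.trans hj.le)] at hstep
  exact hstep.imp (fun h => h.2.1) (fun h => h.2)

end Topmost

theorem IsTopmost.subset_wordValues_maximalSubgroup {S : Type*} [Monoid S] [Finite S] {W : ℕ → ℕ}
    {M N : ℕ} {E : Set S} {e v : S} (hv : IsTopmost E v) (hve : v ∈ maximalSubgroup e)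
    (hb : IsBlockGroup S) (hM : 2 ≤ M) (hcard : Nat.card S ≤ M) (hW : IsBlockWord W M N)
    (hE : E ⊆ wordValues W (M * N) E) :
    letI := maximalSubgroup.group hve.1.1
    let F : Set (maximalSubgroup e) := {g | (g : S) ∈ E ∨ g = 1}
    F ⊆ wordValues W (M * N) F := by
  have he := hve.1.1
  let := maximalSubgroup.group he
  rintro F g hg
  by_cases hg1 : g = 1
  · refine ⟨fun _ => 1, fun _ => Or.inr rfl, ?_⟩
    rw [hg1, ← one_mul (seqProd _ _), mul_seqProd_eq_self _ fun _ _ => mul_one 1]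
  have hgE : (g : S) ∈ E := hg.resolve_right hg1
  have hgne : ¬ IsIdempotentElem (g : S) := fun h =>
    hg1 (IsIdempotentElem.iff_eq_one.1 (Subtype.ext h))
  have hgv : IsFactor (g : S) v := by
    have hgv : g * (g⁻¹ * ⟨v, hve⟩) = ⟨v, hve⟩ := mul_inv_cancel_left _ _
    exact ⟨1, (g⁻¹ * ⟨v, hve⟩ : maximalSubgroup e), by
      rw [one_mul, ← MulMemClass.coe_mul]; exact congrArg Subtype.val hgv⟩
  obtain ⟨e', hge', a, haE, hag, ha⟩ :=
    (hv.of_isFactor hgE hgne hgv).exists_letters hb hM hcard hW hE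
  obtain rfl := hb.isSource_unique hge'.1 g.2.1
  have hunit : ∀ t, ∃ b ∈ F, t < N → e' * a t = b := fun t => by
    by_cases h : a t ∈ maximalSubgroup e'
    · exact ⟨⟨a t, h⟩, Or.inl (haE t), fun _ => h.1.2.1⟩
    · exact ⟨1, Or.inr rfl, fun ht => (ha t ht).resolve_right h⟩
  choose b hbF hab using hunit
  refine ⟨b, hbF, Subtype.ext ?_⟩
  rw [← maximalSubgroup.coe_seqProd he fun i hi => hab (W i) (hW.lt hi), hag, g.2.1.2.1]

/-- A nonidempotent member of `E` that is as high as possible would lie in a maximal subgroup,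
whose solvability would make it the neutral element. -/
theorem IsBlockGroup.isIdempotentElem_of_subset_wordValues {S : Type u} [Monoid S] [Finite S]
    (hb : IsBlockGroup S) (hsolv : HasSolvableSubgroups S) {W : ℕ → ℕ} {M N : ℕ} {E : Set S}
    (hM : 2 ≤ M) (hcard : Nat.card S ≤ M) (hpow : ∀ x : S, IsIdempotentElem (x ^ M))
    (hW : IsBlockWord W M N) (hE : E ⊆ wordValues W (M * N) E) :
    ∀ x ∈ E, IsIdempotentElem x := by
  intro x hx
  by_contra hne
  obtain ⟨v, hv⟩ := exists_isTopmost hx hne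
  obtain ⟨e, hve, -⟩ := hv.exists_letters hb hM hcard hW hE
  have he := hve.1.1
  let := maximalSubgroup.group he
  have : Group.IsSolvable (maximalSubgroup e) := hsolv _ _ ⟨MulEquiv.refl _⟩
  have hv1 : (⟨v, hve⟩ : maximalSubgroup e) = 1 := subset_one_of_subset_wordValues hW
    (maximalSubgroup.pow_eq_one he (by omega) hpow)
    (hv.subset_wordValues_maximalSubgroup hve hb hM hcard hW hE) (Or.inl hv.mem)
  have hve1 : v = e := congrArg Subtype.val hv1
  exact hv.not_isIdempotentElem (hve1 ▸ he)

/-! ### Block words in which close letters are scattered -/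

/-- Among the first `n` positions of `W`, equal letters are more than `k` apart, and two different
letters come within distance `k` of each other at most once. -/
structure IsScattered (W : ℕ → ℕ) (n k : ℕ) : Prop where
  eq_of_near : ∀ {i j}, i < n → j < n → W i = W j → i ≤ j + k → j ≤ i + k → i = j
  eq_of_pair : ∀ {i i' u u'}, i < n → i' < n → u < n → u' < n → W i = W u → W i' = W u' →
    i ≠ i' → i ≤ i' + k → i' ≤ i + k → u ≤ u' + k → u' ≤ u + k → i = u

/-- The sequence running through the residues modulo `N` in blocks, with step `B ^ j` in the block
number `j`. -/
def stepWord (B N : ℕ) (i : ℕ) : ℕ := B ^ (i / N) * (i % N) % N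

namespace stepWord

variable {B N M k i i' u u' : ℕ}

theorem eq_of_div_eq (hBN : Nat.Coprime B N) (hN : 0 < N) (h : stepWord B N i = stepWord B N u)
    (hblock : i / N = u / N) : i = u := by
  unfold stepWord at h
  rw [hblock] at h
  have hmod : i % N = u % N :=
    (Nat.ModEq.cancel_left_of_coprime (hBN.pow_left (u / N)).symm h).eq_of_lt_of_lt
      (Nat.mod_lt _ hN) (Nat.mod_lt _ hN)
  rw [← Nat.div_add_mod i N, ← Nat.div_add_mod u N, hblock, hmod]

theorem isBlockWord (hBN : Nat.Coprime B N) (M : ℕ) : IsBlockWord (stepWord B N) M N := by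
  intro j _
  rcases Nat.eq_zero_or_pos N with rfl | hN
  · simp [Set.BijOn, Set.MapsTo, Set.InjOn, Set.SurjOn]
  have hmaps : Set.MapsTo (fun s => stepWord B N (j * N + s)) (Set.Iio N) (Set.Iio N) :=
    fun s _ => Nat.mod_lt _ hN
  refine (Set.Finite.injOn_iff_bijOn_of_mapsTo (Set.finite_Iio N) hmaps).1 ?_
  intro s hs s' hs' h
  have hdiv : ∀ s ∈ Set.Iio N, (j * N + s) / N = j := fun s hs => by
    rw [mul_comm, Nat.mul_add_div hN, Nat.div_eq_of_lt hs, add_zero]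
  have := eq_of_div_eq hBN hN h (by rw [hdiv s hs, hdiv s' hs'])
  omega

theorem exists_add_modEq (hkN : k < N) (hii : i < i') (hik : i' ≤ i + k) :
    ∃ a b, 0 < a ∧ a + b ≤ k ∧
      stepWord B N i + B ^ (i / N) * (a + B * b) ≡ stepWord B N i' [MOD N] := by
  have hN : 0 < N := by omega
  have hi := Nat.div_add_mod' i N
  have hi' := Nat.div_add_mod' i' N
  have hm := Nat.mod_lt i hN
  set j := i / N with hj
  have hle : j ≤ i' / N := Nat.div_le_div_right hii.le
  have hlt : i' / N < j + 2 := by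
    rw [Nat.div_lt_iff_lt_mul hN, Nat.add_mul]
    omega
  have hmod : ∀ x, stepWord B N x ≡ B ^ (x / N) * (x % N) [MOD N] := fun x => Nat.mod_modEq _ _
  obtain h | h : i' / N = j ∨ i' / N = j + 1 := by omega
  · rw [h] at hi'
    have hmod' : i' % N = i % N + (i' - i) := by omega
    refine ⟨i' - i, 0, by omega, by omega, ?_⟩
    refine ((hmod i).add_right _).trans (Nat.ModEq.trans ?_ (hmod i').symm)
    rw [h, hmod', ← hj, mul_zero, add_zero, mul_add]
  · rw [h, Nat.succ_mul] at hi'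
    refine ⟨N - i % N, i' % N, by omega, by omega, ?_⟩
    refine ((hmod i).add_right _).trans (Nat.ModEq.trans ?_ (hmod i').symm)
    rw [h, ← hj, ← mul_add, ← add_assoc, Nat.add_sub_cancel' hm.le, mul_add, ← mul_assoc,
      ← pow_succ]
    simp

/-- The size of the difference of two close letters makes it an honest natural number rather than
a residue, and its `B`-adic valuation tells the block. -/
theorem exists_gap (hkB : k < B) (hN : 2 * (k * B ^ M) < N) (hi : i < M * N) (hii : i < i')
    (hik : i' ≤ i + k) :
    ∃ d, 0 < d ∧ 2 * d < N ∧ B ^ (i / N) ∣ d ∧ ¬ B ^ (i / N + 1) ∣ d ∧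
      stepWord B N i + d ≡ stepWord B N i' [MOD N] := by
  have hB : 0 < B := by omega
  have hBM : 0 < B ^ M := pow_pos hB M
  have hkN : k < N := by nlinarith
  obtain ⟨a, b, ha, hab, hmod⟩ := exists_add_modEq (B := B) hkN hii hik
  have hpos : 0 < B ^ (i / N) := pow_pos hB _
  refine ⟨_, by positivity, ?_, dvd_mul_right _ _, ?_, hmod⟩
  · have hdiv : i / N < M := by rwa [Nat.div_lt_iff_lt_mul (by omega)]
    have hle : a + B * b ≤ B * k := by nlinarith
    have : B ^ (i / N) * (a + B * b) ≤ k * B ^ M := calc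
      B ^ (i / N) * (a + B * b) ≤ B ^ (i / N) * (B * k) := Nat.mul_le_mul_left _ hle
      _ = k * B ^ (i / N + 1) := by ring
      _ ≤ k * B ^ M := Nat.mul_le_mul_left _ (Nat.pow_le_pow_right hB hdiv)
    omega
  · rw [pow_succ, Nat.mul_dvd_mul_iff_left hpos, Nat.dvd_add_left (dvd_mul_right B b)]
    exact Nat.not_dvd_of_pos_of_lt ha (by omega)

theorem ne_of_near (hkB : k < B) (hN : 2 * (k * B ^ M) < N) (hi : i < M * N) (hii : i < i')
    (hik : i' ≤ i + k) : stepWord B N i ≠ stepWord B N i' := by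
  obtain ⟨d, hd, hdN, -, -, hmod⟩ := exists_gap hkB hN hi hii hik
  intro h
  rw [← h, Nat.add_modEq_left_iff] at hmod
  exact Nat.not_dvd_of_pos_of_lt hd (by omega) hmod

theorem eq_of_pair (hBN : Nat.Coprime B N) (hkB : k < B) (hN : 2 * (k * B ^ M) < N)
    (hi : i < M * N) (hu : u < M * N) (h : stepWord B N i = stepWord B N u)
    (h' : stepWord B N i' = stepWord B N u') (hii : i < i') (hik : i' ≤ i + k) (huu : u < u')
    (huk : u' ≤ u + k) : i = u := by
  obtain ⟨d, -, hdN, hdvd, hndvd, hmod⟩ := exists_gap hkB hN hi hii hik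
  obtain ⟨d', -, hdN', hdvd', hndvd', hmod'⟩ := exists_gap hkB hN hu huu huk
  rw [← h, ← h'] at hmod'
  obtain rfl : d = d' := (Nat.ModEq.add_left_cancel' _ (hmod.trans hmod'.symm)).eq_of_lt_of_lt
    (by omega) (by omega)
  refine eq_of_div_eq hBN (by omega) h (le_antisymm ?_ ?_) <;> by_contra! hlt
  · exact hndvd' ((pow_dvd_pow B hlt).trans hdvd)
  · exact hndvd ((pow_dvd_pow B hlt).trans hdvd')

theorem not_opposite_pair (hkB : k < B) (hN : 2 * (k * B ^ M) < N) (hi : i < M * N)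
    (hu : u' < M * N) (h : stepWord B N i = stepWord B N u)
    (h' : stepWord B N i' = stepWord B N u') (hii : i < i') (hik : i' ≤ i + k) (huu : u' < u) :
    ¬ u ≤ u' + k := by
  intro huk
  obtain ⟨d, hd, hdN, -, -, hmod⟩ := exists_gap hkB hN hi hii hik
  obtain ⟨d', -, hdN', -, -, hmod'⟩ := exists_gap hkB hN hu huu huk
  rw [← h, ← h'] at hmod'
  have hsum := (hmod.add_right d').trans hmod'
  rw [add_assoc, Nat.add_modEq_left_iff] at hsum
  exact Nat.not_dvd_of_pos_of_lt (by omega) (by omega) hsum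

theorem isScattered (hBN : Nat.Coprime B N) (hkB : k < B) (hN : 2 * (k * B ^ M) < N) :
    IsScattered (stepWord B N) (M * N) k := by
  have hnear : ∀ {i j}, i < M * N → j < M * N → stepWord B N i = stepWord B N j → i ≤ j + k →
      j ≤ i + k → i = j := by
    intro i j hi hj h hij hji
    rcases lt_trichotomy i j with hlt | rfl | hlt
    · exact (ne_of_near hkB hN hi hlt hji h).elim
    · rfl
    · exact (ne_of_near hkB hN hj hlt hij h.symm).elim
  refine ⟨hnear, ?_⟩
  intro i i' u u' hi hi' hu hu' h h' hne hik hik' huk huk'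
  have hne' : u ≠ u' := by
    rintro rfl
    exact hne (hnear hi hi' (h.trans h'.symm) hik hik')
  rcases hne.lt_or_gt with hlt | hlt <;> rcases hne'.lt_or_gt with hlt' | hlt'
  · exact eq_of_pair hBN hkB hN hi hu h h' hlt hik' hlt' huk'
  · exact (not_opposite_pair hkB hN hi hu' h h' hlt hik' hlt' huk).elim
  · exact (not_opposite_pair hkB hN hi' hu h' h hlt hik hlt' huk').elim
  · obtain rfl := eq_of_pair hBN hkB hN hi' hu' h' h hlt hik hlt' huk
    exact hnear hi hu h (by omega) (by omega)

end stepWord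

theorem exists_isBlockWord_isScattered (M k : ℕ) :
    ∃ (W : ℕ → ℕ) (N : ℕ), 0 < N ∧ IsBlockWord W M N ∧ IsScattered W (M * N) k := by
  have hcop : Nat.Coprime (k + 1) (2 * k * (k + 1) ^ (M + 1) + 1) := by
    rw [pow_succ, ← mul_assoc]
    simp
  have hpow : (k + 1) ^ M ≤ (k + 1) ^ (M + 1) := Nat.pow_le_pow_right (by omega) (by omega)
  exact ⟨_, _, Nat.succ_pos _, stepWord.isBlockWord hcop M,
    stepWord.isScattered hcop (by omega) (by nlinarith)⟩

/-! ### Systems of partial injections that are locally separated by two-colourings -/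

open scoped SetRel

section Relations

variable {α : Type*}

/-- The binary relation `a` is the graph of a partial injection. -/
def IsPartialInj (a : SetRel α α) : Prop := Relator.BiUnique fun x y => x ~[a] y

/-- The ends of each pair in `a` have the same colour. -/
def IsFlat (c : α → Bool) (a : SetRel α α) : Prop := ∀ p ∈ a, c p.1 = c p.2

/-- All pairs in `a` are coloured in the same way. -/
def IsUniform (c : α → Bool) (a : SetRel α α) : Prop :=
  ∀ p ∈ a, ∀ q ∈ a, c p.1 = c q.1 ∧ c p.2 = c q.2

/-- Every member of `K` is flat or uniform under the colouring `c`. These are the relations that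
`c` maps to the Brandt monoid, flat ones going to the identity and uniform ones to matrix units. -/
def IsAdmissible (c : α → Bool) (K : Finset (SetRel α α)) : Prop :=
  ∀ a ∈ K, IsFlat c a ∨ IsUniform c a

/-- `T` is a set of partial injections closed under intersection and composition. -/
structure IsInjSystem (T : Set (SetRel α α)) : Prop where
  inj : ∀ {a}, a ∈ T → IsPartialInj a
  inter : ∀ {a b}, a ∈ T → b ∈ T → a ∩ b ∈ T
  comp : ∀ {a b}, a ∈ T → b ∈ T → a ○ b ∈ T

theorem isUniform_of_subsingleton (c : α → Bool) {a : SetRel α α} (h : a.Subsingleton) :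
    IsUniform c a := fun p hp q hq => by rw [h hp hq]; exact ⟨rfl, rfl⟩

theorem isPartialInj_of_subsingleton {a : SetRel α α} (h : a.Subsingleton) : IsPartialInj a :=
  ⟨fun _ _ _ hx hy => congrArg Prod.fst (h hx hy), fun _ _ _ hx hy => congrArg Prod.snd (h hx hy)⟩

theorem IsPartialInj.subsingleton_comp {a b : SetRel α α} (ha : IsPartialInj a)
    (hb : IsPartialInj b) (h : ∀ ⦃x y z x' y' z'⦄, x ~[a] y → y ~[b] z → x' ~[a] y' → y' ~[b] z' →
      y = y') : (a ○ b).Subsingleton := by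
  rintro ⟨x, z⟩ ⟨y, hxy, hyz⟩ ⟨x', z'⟩ ⟨y', hxy', hyz'⟩
  obtain rfl := h hxy hyz hxy' hyz'
  exact Prod.ext (ha.1 hxy hxy') (hb.2 hyz hyz')

theorem IsPartialInj.subsingleton_comp_of_left {a b : SetRel α α} (ha : a.Subsingleton)
    (hb : IsPartialInj b) : (a ○ b).Subsingleton :=
  (isPartialInj_of_subsingleton ha).subsingleton_comp hb fun _ _ _ _ _ _ hxy _ hxy' _ =>
    congrArg Prod.snd (ha hxy hxy')

theorem IsPartialInj.subsingleton_comp_of_right {a b : SetRel α α} (ha : IsPartialInj a)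
    (hb : b.Subsingleton) : (a ○ b).Subsingleton :=
  ha.subsingleton_comp (isPartialInj_of_subsingleton hb) fun _ _ _ _ _ _ _ hyz _ hyz' =>
    congrArg Prod.fst (hb hyz hyz')

/-- The underlying type of the ai-semiring of a system of partial injections, in which the sum is
the intersection and the product is the composition. -/
def IsInjSystem.Carrier {T : Set (SetRel α α)} (_ : IsInjSystem T) : Type _ := T

instance {T : Set (SetRel α α)} (hT : IsInjSystem T) : AISemiring hT.Carrier where
  add a b := ⟨a.1 ∩ b.1, hT.inter a.2 b.2⟩
  mul a b := ⟨a.1 ○ b.1, hT.comp a.2 b.2⟩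
  add_assoc a b c := Subtype.ext (Set.inter_assoc _ _ _)
  add_comm a b := Subtype.ext (Set.inter_comm _ _)
  mul_assoc a b c := Subtype.ext (SetRel.comp_assoc _ _ _)
  left_distrib a b c := Subtype.ext <| Set.Subset.antisymm
    (fun _ ⟨z, hx, hb, hc⟩ => ⟨⟨z, hx, hb⟩, ⟨z, hx, hc⟩⟩)
    (fun _ ⟨⟨z, hx, hb⟩, ⟨w, hx', hc⟩⟩ => ⟨z, hx, hb, by rwa [(hT.inj a.2).2 hx hx']⟩)
  right_distrib a b c := Subtype.ext <| Set.Subset.antisymm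
    (fun _ ⟨z, ⟨ha, hb⟩, hy⟩ => ⟨⟨z, ha, hy⟩, ⟨z, hb, hy⟩⟩)
    (fun _ ⟨⟨z, ha, hy⟩, ⟨w, hb, hy'⟩⟩ => ⟨z, ⟨ha, by rwa [(hT.inj c.2).1 hy hy']⟩, hy⟩)
  add_idem a := Subtype.ext (Set.inter_self _)

end Relations

/-- `T` is a system of partial injections of `{0, …, L}` such that for any at most `k` of its
members, points and domains are separated by admissible colourings. -/
structure IsSeparated (L : ℕ) (T : Set (SetRel ℕ ℕ)) (k : ℕ) : Prop extends IsInjSystem T where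
  pos : 0 < L
  bdd : ∀ {a}, a ∈ T → ∀ {x y}, x ~[a] y → x ≤ L ∧ y ≤ L
  points : ∀ {K : Finset (SetRel ℕ ℕ)}, ↑K ⊆ T → K.card ≤ k →
    ∀ {x y}, x ≤ L → y ≤ L → x ≠ y → ∃ c, IsAdmissible c K ∧ c x ≠ c y
  dom : ∀ {K : Finset (SetRel ℕ ℕ)}, ↑K ⊆ T → K.card ≤ k →
    ∀ {a}, a ∈ K → ∀ {x}, x ≤ L → x ∉ a.dom →
      ∃ c, IsAdmissible c K ∧ IsUniform c a ∧ ∀ p ∈ a, c p.1 ≠ c x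

/-- The subsingleton relations on `{0, …, L}`. -/
def smallRels (L : ℕ) : Set (SetRel ℕ ℕ) :=
  {a | a.Subsingleton ∧ ∀ x y, x ~[a] y → x ≤ L ∧ y ≤ L}

/-- The points of the `i`-th of the consecutive intervals of length `L`; neighbouring segments
share an end. -/
def wordSegment (L i : ℕ) : Set ℕ := Set.Icc (i * L) (i * L + L)

/-- The union of the copies of `a` shifted to the segments of the positions of the letter `t` among
the first `n` positions of `W`. -/
def liftRel (W : ℕ → ℕ) (n L t : ℕ) (a : SetRel ℕ ℕ) : SetRel ℕ ℕ :=
  {p | ∃ i < n, W i = t ∧ p.1 ∈ wordSegment L i ∧ p.2 ∈ wordSegment L i ∧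
    (p.1 - i * L) ~[a] (p.2 - i * L)}

/-- The subsingleton relations on `{0, …, n * L}` and the lifted members of `T`. -/
def extendRels (W : ℕ → ℕ) (n L : ℕ) (T : Set (SetRel ℕ ℕ)) : Set (SetRel ℕ ℕ) :=
  smallRels (n * L) ∪ {b | ∃ t, ∃ a ∈ T, b = liftRel W n L t a}

theorem smallRels_isSeparated {L : ℕ} (hL : 0 < L) (k : ℕ) : IsSeparated L (smallRels L) k where
  pos := hL
  bdd ha := ha.2 _ _
  inj ha := isPartialInj_of_subsingleton ha.1
  inter ha _ := ⟨ha.1.anti Set.inter_subset_left, fun x y h => ha.2 x y h.1⟩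
  comp ha hb := ⟨(isPartialInj_of_subsingleton hb.1).subsingleton_comp_of_left ha.1,
    fun _ _ ⟨_, hxy, hyz⟩ => ⟨(ha.2 _ _ hxy).1, (hb.2 _ _ hyz).2⟩⟩
  points hK _ x y _ _ hne := ⟨fun z => decide (z = x),
    fun _ ha => Or.inr (isUniform_of_subsingleton _ (hK ha).1), by simp [hne.symm]⟩
  dom hK _ a ha x _ hxa := ⟨fun z => decide (z = x),
    fun _ ha => Or.inr (isUniform_of_subsingleton _ (hK ha).1),
    isUniform_of_subsingleton _ (hK ha).1, fun p hp => by
      have : p.1 ≠ x := fun h => hxa ⟨p.2, h ▸ hp⟩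
      simpa using this⟩

section Segment

variable {L i j x : ℕ}

theorem mul_mem_wordSegment (L i : ℕ) : i * L ∈ wordSegment L i := ⟨le_rfl, Nat.le_add_right _ _⟩

theorem exists_mem_wordSegment_lt {n : ℕ} (hL : 0 < L) (hx : x < n * L) :
    ∃ i < n, x ∈ wordSegment L i ∧ x < i * L + L :=
  have hlt := Nat.lt_div_mul_add (a := x) hL
  ⟨x / L, (Nat.div_lt_iff_lt_mul hL).2 hx, ⟨Nat.div_mul_le_self x L, hlt.le⟩, hlt⟩

theorem exists_mem_wordSegment_gt {n : ℕ} (hL : 0 < L) (hx : 0 < x) (hxn : x ≤ n * L) :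
    ∃ i < n, x ∈ wordSegment L i ∧ i * L < x := by
  obtain ⟨i, hi, hxi, hlt⟩ := exists_mem_wordSegment_lt hL (Nat.sub_one_lt_of_le hx hxn)
  have := hxi.1
  exact ⟨i, hi, ⟨by omega, by omega⟩, by omega⟩

theorem mem_wordSegment_add {y : ℕ} (i : ℕ) (hy : y ≤ L) : i * L + y ∈ wordSegment L i := by
  simp [wordSegment, hy]

theorem sub_le_of_mem_wordSegment (hx : x ∈ wordSegment L i) : x - i * L ≤ L :=
  Nat.sub_le_iff_le_add'.2 hx.2

theorem le_mul_of_mem_wordSegment {n : ℕ} (hi : i < n) (hx : x ∈ wordSegment L i) : x ≤ n * L := by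
  have : (i + 1) * L ≤ n * L := Nat.mul_le_mul_right L hi
  rw [Nat.succ_mul] at this
  exact hx.2.trans this

theorem mul_add_le_mul (L : ℕ) (hij : i < j) : i * L + L ≤ j * L := by
  rw [← Nat.succ_mul]
  exact Nat.mul_le_mul_right L hij

theorem eq_succ_of_mem_wordSegment (hL : 0 < L) (hi : x ∈ wordSegment L i)
    (hj : x ∈ wordSegment L j) (hij : i < j) : j = i + 1 ∧ x = j * L := by
  have hle := mul_add_le_mul L hij
  refine ⟨?_, le_antisymm (hi.2.trans hle) hj.1⟩
  by_contra hne
  have := mul_add_le_mul L (show i + 1 < j by omega)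
  rw [Nat.succ_mul] at this
  exact absurd (hj.1.trans hi.2) (by omega)

theorem meet_of_mem_wordSegment (hL : 0 < L) (hi : x ∈ wordSegment L i) (hj : x ∈ wordSegment L j)
    (hij : i ≠ j) : i ≤ j + 1 ∧ j ≤ i + 1 ∧ x = max i j * L := by
  rcases hij.lt_or_gt with h | h
  · obtain ⟨rfl, hx⟩ := eq_succ_of_mem_wordSegment hL hi hj h
    exact ⟨by omega, le_rfl, by rwa [max_eq_right h.le]⟩
  · obtain ⟨rfl, hx⟩ := eq_succ_of_mem_wordSegment hL hj hi h
    exact ⟨le_rfl, by omega, by rwa [max_eq_left h.le]⟩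

end Segment

section Lift

variable {W : ℕ → ℕ} {n k L : ℕ} {T : Set (SetRel ℕ ℕ)}

theorem IsScattered.segment_unique (hW : IsScattered W n k) (hk : 1 ≤ k) (hL : 0 < L) {i j x : ℕ}
    (hi : i < n) (hj : j < n) (hxi : x ∈ wordSegment L i) (hxj : x ∈ wordSegment L j)
    (hij : W i = W j) : i = j := by
  by_contra hne
  obtain ⟨hle, hle', -⟩ := meet_of_mem_wordSegment hL hxi hxj hne
  exact hne (hW.eq_of_near hi hj hij (by omega) (by omega))

theorem IsScattered.meet_unique (hW : IsScattered W n k) (hk : 1 ≤ k) (hL : 0 < L)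
    {i j i' j' x y : ℕ} (hi : i < n) (hj : j < n) (hi' : i' < n) (hj' : j' < n)
    (hxi : x ∈ wordSegment L i) (hxj : x ∈ wordSegment L j) (hyi : y ∈ wordSegment L i')
    (hyj : y ∈ wordSegment L j') (hii : W i = W i') (hjj : W j = W j') (hne : W i ≠ W j) :
    x = y := by
  have hij : i ≠ j := ne_of_apply_ne W hne
  obtain ⟨h₁, h₂, rfl⟩ := meet_of_mem_wordSegment hL hxi hxj hij
  obtain ⟨h₃, h₄, rfl⟩ := meet_of_mem_wordSegment hL hyi hyj (ne_of_apply_ne W (hii ▸ hjj ▸ hne))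
  rw [hW.eq_of_pair hi hj hi' hj' hii hjj hij (by omega) (by omega) (by omega) (by omega),
    hW.eq_of_pair hj hi hj' hi' hjj hii hij.symm (by omega) (by omega) (by omega) (by omega)]

theorem liftRel_mem {a : SetRel ℕ ℕ} {i x y : ℕ} (hi : i < n) (hx : x ≤ L) (hy : y ≤ L)
    (hxy : x ~[a] y) : (i * L + x) ~[liftRel W n L (W i) a] (i * L + y) :=
  ⟨i, hi, rfl, mem_wordSegment_add i hx, mem_wordSegment_add i hy, by simpa using hxy⟩

theorem liftRel_isPartialInj (hW : IsScattered W n k) (hk : 1 ≤ k) (hL : 0 < L) {a : SetRel ℕ ℕ}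
    (ha : IsPartialInj a) (t : ℕ) : IsPartialInj (liftRel W n L t a) := by
  constructor
  · rintro x x' y ⟨i, hi, hit, hx, hy, hxy⟩ ⟨j, hj, hjt, hx', hy', hxy'⟩
    obtain rfl := hW.segment_unique hk hL hi hj hy hy' (hit.trans hjt.symm)
    have := ha.1 hxy hxy'
    have := hx.1
    have := hx'.1
    dsimp only at *
    omega
  · rintro x y y' ⟨i, hi, hit, hx, hy, hxy⟩ ⟨j, hj, hjt, hx', hy', hxy'⟩
    obtain rfl := hW.segment_unique hk hL hi hj hx hx' (hit.trans hjt.symm)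
    have := ha.2 hxy hxy'
    have := hy.1
    have := hy'.1
    dsimp only at *
    omega

theorem liftRel_inter (hW : IsScattered W n k) (hk : 1 ≤ k) (hL : 0 < L) (a b : SetRel ℕ ℕ)
    (t : ℕ) : liftRel W n L t a ∩ liftRel W n L t b = liftRel W n L t (a ∩ b) := by
  refine Set.Subset.antisymm ?_ ?_
  · rintro _ ⟨⟨i, hi, hit, hx, hy, hxy⟩, ⟨j, hj, hjt, hx', hy', hxy'⟩⟩
    obtain rfl := hW.segment_unique hk hL hi hj hx hx' (hit.trans hjt.symm)
    exact ⟨i, hi, hit, hx, hy, hxy, hxy'⟩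
  · rintro _ ⟨i, hi, hit, hx, hy, hxy, hxy'⟩
    exact ⟨⟨i, hi, hit, hx, hy, hxy⟩, ⟨i, hi, hit, hx, hy, hxy'⟩⟩

theorem liftRel_comp (hW : IsScattered W n k) (hk : 1 ≤ k) (hL : 0 < L) {a : SetRel ℕ ℕ}
    (ha : ∀ {x y}, x ~[a] y → y ≤ L) (b : SetRel ℕ ℕ) (t : ℕ) :
    liftRel W n L t a ○ liftRel W n L t b = liftRel W n L t (a ○ b) := by
  refine Set.Subset.antisymm ?_ ?_
  · rintro _ ⟨y, ⟨i, hi, hit, hx, hy, hxy⟩, ⟨j, hj, hjt, hy', hz, hyz⟩⟩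
    obtain rfl := hW.segment_unique hk hL hi hj hy hy' (hit.trans hjt.symm)
    exact ⟨i, hi, hit, hx, hz, _, hxy, hyz⟩
  · rintro _ ⟨i, hi, hit, hx, hz, y, hxy, hyz⟩
    have hy := mem_wordSegment_add i (ha hxy)
    exact ⟨i * L + y, ⟨i, hi, hit, hx, hy, by simpa using hxy⟩,
      ⟨i, hi, hit, hy, hz, by simpa using hyz⟩⟩

theorem liftRel_inter_subsingleton (hW : IsScattered W n k) (hk : 1 ≤ k) (hL : 0 < L)
    (a b : SetRel ℕ ℕ) {t s : ℕ} (hts : t ≠ s) :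
    (liftRel W n L t a ∩ liftRel W n L s b).Subsingleton := by
  rintro _ ⟨⟨i, hi, rfl, hxi, hyi, -⟩, ⟨j, hj, rfl, hxj, hyj, -⟩⟩
    _ ⟨⟨i', hi', hii, hxi', hyi', -⟩, ⟨j', hj', hjj, hxj', hyj', -⟩⟩
  exact Prod.ext
    (hW.meet_unique hk hL hi hj hi' hj' hxi hxj hxi' hxj' hii.symm hjj.symm hts)
    (hW.meet_unique hk hL hi hj hi' hj' hyi hyj hyi' hyj' hii.symm hjj.symm hts)

theorem liftRel_comp_subsingleton (hW : IsScattered W n k) (hk : 1 ≤ k) (hL : 0 < L)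
    {a b : SetRel ℕ ℕ} (ha : IsPartialInj a) (hb : IsPartialInj b) {t s : ℕ} (hts : t ≠ s) :
    (liftRel W n L t a ○ liftRel W n L s b).Subsingleton := by
  refine (liftRel_isPartialInj hW hk hL ha t).subsingleton_comp
    (liftRel_isPartialInj hW hk hL hb s) ?_
  rintro _ _ _ _ _ _ ⟨i, hi, rfl, -, hyi, -⟩ ⟨j, hj, rfl, hyj, -⟩ ⟨i', hi', hii, -, hyi', -⟩
    ⟨j', hj', hjj, hyj', -⟩
  exact hW.meet_unique hk hL hi hj hi' hj' hyi hyj hyi' hyj' hii.symm hjj.symm hts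

theorem extendRels_bdd {a : SetRel ℕ ℕ} (ha : a ∈ extendRels W n L T) {x y : ℕ} (h : x ~[a] y) :
    x ≤ n * L ∧ y ≤ n * L := by
  rcases ha with ha | ⟨t, b, -, rfl⟩
  · exact ha.2 x y h
  · obtain ⟨i, hi, -, hx, hy, -⟩ := h
    exact ⟨le_mul_of_mem_wordSegment hi hx, le_mul_of_mem_wordSegment hi hy⟩

theorem extendRels_isPartialInj (hW : IsScattered W n k) (hk : 1 ≤ k) (hL : 0 < L)
    (hT : ∀ {a}, a ∈ T → IsPartialInj a) {a : SetRel ℕ ℕ} (ha : a ∈ extendRels W n L T) :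
    IsPartialInj a := by
  rcases ha with ha | ⟨t, b, hb, rfl⟩
  · exact isPartialInj_of_subsingleton ha.1
  · exact liftRel_isPartialInj hW hk hL (hT hb) t

theorem extendRels_inter (hW : IsScattered W n k) (hk : 1 ≤ k) (hL : 0 < L)
    (hT : ∀ {a b}, a ∈ T → b ∈ T → a ∩ b ∈ T) {a b : SetRel ℕ ℕ} (ha : a ∈ extendRels W n L T)
    (hb : b ∈ extendRels W n L T) : a ∩ b ∈ extendRels W n L T := by
  have hbdd : ∀ x y, x ~[a ∩ b] y → x ≤ n * L ∧ y ≤ n * L := fun x y h => extendRels_bdd ha h.1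
  rcases ha with ha | ⟨t, a, ha, rfl⟩
  · exact Or.inl ⟨ha.1.anti Set.inter_subset_left, hbdd⟩
  rcases hb with hb | ⟨s, b, hb, rfl⟩
  · exact Or.inl ⟨hb.1.anti Set.inter_subset_right, hbdd⟩
  rcases eq_or_ne t s with rfl | hts
  · exact Or.inr ⟨t, a ∩ b, hT ha hb, liftRel_inter hW hk hL a b t⟩
  · exact Or.inl ⟨liftRel_inter_subsingleton hW hk hL a b hts, hbdd⟩

theorem extendRels_comp (hW : IsScattered W n k) (hk : 1 ≤ k) (hT : IsSeparated L T k)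
    {a b : SetRel ℕ ℕ} (ha : a ∈ extendRels W n L T) (hb : b ∈ extendRels W n L T) :
    a ○ b ∈ extendRels W n L T := by
  have hbdd : ∀ x y, x ~[a ○ b] y → x ≤ n * L ∧ y ≤ n * L := fun x y ⟨z, hxz, hzy⟩ =>
    ⟨(extendRels_bdd ha hxz).1, (extendRels_bdd hb hzy).2⟩
  have hai := extendRels_isPartialInj hW hk hT.pos hT.inj ha
  have hbi := extendRels_isPartialInj hW hk hT.pos hT.inj hb
  rcases ha with ha | ⟨t, a, ha, rfl⟩
  · exact Or.inl ⟨hbi.subsingleton_comp_of_left ha.1, hbdd⟩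
  rcases hb with hb | ⟨s, b, hb, rfl⟩
  · exact Or.inl ⟨hai.subsingleton_comp_of_right hb.1, hbdd⟩
  rcases eq_or_ne t s with rfl | hts
  · exact Or.inr ⟨t, a ○ b, hT.comp ha hb, liftRel_comp hW hk hT.pos (fun h => (hT.bdd ha h).2) b t⟩
  · exact Or.inl ⟨liftRel_comp_subsingleton hW hk hT.pos (hT.inj ha) (hT.inj hb) hts, hbdd⟩

theorem extendRels_isInjSystem (hW : IsScattered W n k) (hk : 1 ≤ k) (hT : IsSeparated L T k) :
    IsInjSystem (extendRels W n L T) where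
  inj := extendRels_isPartialInj hW hk hT.pos hT.inj
  inter := extendRels_inter hW hk hT.pos hT.inter
  comp := extendRels_comp hW hk hT

end Lift

/-! ### Runs of letters of a small alphabet in a scattered word -/

/-- The end `x` of position `x - 1` is reached from an occurrence of `t` to its left through
letters of `D`. -/
def RightRun (W : ℕ → ℕ) (n : ℕ) (D : Finset ℕ) (t x : ℕ) : Prop :=
  ∃ i < x, i < n ∧ W i = t ∧ ∀ j, i < j → j < x → W j ∈ D

/-- The beginning `x` of position `x` is reached from an occurrence of `t` to its right through
letters of `D`. -/
def LeftRun (W : ℕ → ℕ) (n : ℕ) (D : Finset ℕ) (t x : ℕ) : Prop :=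
  ∃ i, x ≤ i ∧ i < n ∧ W i = t ∧ ∀ j, x ≤ j → j < i → W j ∈ D

section Runs

variable {W : ℕ → ℕ} {n k i : ℕ} {D : Finset ℕ}

theorem rightRun_succ_iff {t : ℕ} (hiD : W i ∈ D) (hit : W i ≠ t) :
    RightRun W n D t (i + 1) ↔ RightRun W n D t i := by
  constructor
  · rintro ⟨j, hj, hjn, hjt, hD⟩
    have hji : j ≠ i := by rintro rfl; exact hit hjt
    exact ⟨j, by omega, hjn, hjt, fun l hjl hli => hD l hjl (by omega)⟩
  · rintro ⟨j, hj, hjn, hjt, hD⟩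
    refine ⟨j, by omega, hjn, hjt, fun l hjl hli => ?_⟩
    rcases Nat.lt_succ_iff_lt_or_eq.1 hli with hli | rfl
    · exact hD l hjl hli
    · exact hiD

theorem leftRun_succ_iff {t : ℕ} (hiD : W i ∈ D) (hit : W i ≠ t) :
    LeftRun W n D t (i + 1) ↔ LeftRun W n D t i := by
  constructor
  · rintro ⟨j, hj, hjn, hjt, hD⟩
    refine ⟨j, by omega, hjn, hjt, fun l hil hlj => ?_⟩
    rcases hil.eq_or_lt with rfl | hil
    · exact hiD
    · exact hD l hil hlj
  · rintro ⟨j, hj, hjn, hjt, hD⟩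
    have hji : j ≠ i := by rintro rfl; exact hit hjt
    exact ⟨j, by omega, hjn, hjt, fun l hil hlj => hD l (by omega) hlj⟩

theorem rightRun_succ_self (hi : i < n) : RightRun W n D (W i) (i + 1) :=
  ⟨i, by omega, hi, rfl, fun j _ _ => by omega⟩

theorem leftRun_self (hi : i < n) : LeftRun W n D (W i) i :=
  ⟨i, le_rfl, hi, rfl, fun j _ _ => by omega⟩

namespace IsScattered

theorem length_le_of_forall_mem (hW : IsScattered W n k) (hD : D.card ≤ k) {m : ℕ} (him : i + m ≤ n)
    (h : ∀ j, i ≤ j → j < i + m → W j ∈ D) : m ≤ k := by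
  by_contra hm
  have hmaps : ∀ j ∈ Finset.range (k + 1), W (i + j) ∈ D := fun j hj =>
    h _ (by omega) (by have := Finset.mem_range.1 hj; omega)
  have hinj : Set.InjOn (fun j => W (i + j)) (Finset.range (k + 1)) := fun j hj j' hj' hjj => by
    have hj := Finset.mem_range.1 hj
    have hj' := Finset.mem_range.1 hj'
    have := hW.eq_of_near (i := i + j) (j := i + j') (by omega) (by omega) hjj (by omega) (by omega)
    omega
  have hcard := Finset.card_le_card_of_injOn _ hmaps hinj
  rw [Finset.card_range] at hcard
  omega

theorem le_add_of_forall_mem (hW : IsScattered W n k) (hD : D.card ≤ k) {j : ℕ} (hij : i ≤ j)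
    (hj : j < n) (hiD : W i ∈ D) (hjD : W j ∈ D) (h : ∀ l, i < l → l < j → W l ∈ D) :
    j ≤ i + k := by
  have := hW.length_le_of_forall_mem hD (i := i) (m := j - i + 1) (by omega) fun l hil hlj => by
    rcases hil.eq_or_lt with rfl | hil
    · exact hiD
    · rcases Nat.eq_or_lt_of_le (show l ≤ j by omega) with rfl | hlj
      · exact hjD
      · exact h l hil hlj
  omega

theorem not_rightRun (hW : IsScattered W n k) (hD : D.card ≤ k) (hi : i < n) (hiD : W i ∈ D) :
    ¬ RightRun W n D (W i) i := by
  rintro ⟨j, hj, hjn, hjt, hDj⟩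
  have := hW.le_add_of_forall_mem hD hj.le hi (hjt ▸ hiD) hiD hDj
  have := hW.eq_of_near hjn hi hjt (by omega) (by omega)
  omega

theorem not_leftRun_of_rightRun (hW : IsScattered W n k) (hD : D.card ≤ k) {i' t : ℕ} (hi : i < n)
    (hi' : i' < n) (hii : W i = W i') (hiD : W i ∈ D) (htD : t ∈ D) (hr : RightRun W n D t i) :
    ¬ LeftRun W n D t i' := by
  obtain ⟨j, hj, hjn, hjt, hDj⟩ := hr
  rintro ⟨j', hj', hjn', hjt', hDj'⟩
  have hle := hW.le_add_of_forall_mem hD hj.le hi (hjt ▸ htD) hiD hDj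
  have hle' := hW.le_add_of_forall_mem hD hj' hjn' (hii ▸ hiD) (hjt' ▸ htD)
    fun l hil hlj => hDj' l hil.le hlj
  have hi_eq := hW.eq_of_pair hi hjn hi' hjn' hii (hjt.trans hjt'.symm) (by omega) (by omega)
    (by omega) (by omega) (by omega)
  have hj_eq := hW.eq_of_pair hjn hi hjn' hi' (hjt.trans hjt'.symm) hii (by omega) (by omega)
    (by omega) (by omega) (by omega)
  omega

end IsScattered

end Runs

/-! ### Colourings adapted to the letters of a small alphabet -/

/-- On the segments of each letter of `D`, the colouring `c` is either constant on each of them or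
repeats a fixed pattern that is admissible for `K`. -/
def IsGoodColouring (W : ℕ → ℕ) (n L : ℕ) (D : Finset ℕ) (K : Finset (SetRel ℕ ℕ))
    (c : ℕ → Bool) : Prop :=
  ∀ t ∈ D, (∀ i < n, W i = t → ∀ x ∈ wordSegment L i, c x = c (i * L)) ∨
    ∃ c₀, IsAdmissible c₀ K ∧ ∀ i < n, W i = t → ∀ x ∈ wordSegment L i, c x = c₀ (x - i * L)

/-- The points `p` and `z` are equal or all segments that meet the interval between them in more
than an end have letters in `D`. -/
def IsLinked (W : ℕ → ℕ) (L : ℕ) (D : Finset ℕ) (p z : ℕ) : Prop :=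
  p = z ∨ ∀ i, i * L < max p z → min p z < i * L + L → W i ∈ D

open Classical in
/-- The colour of the point `x * L` in a colouring with the pattern `c₀` on the segments of the
letter `t`: the colours at the two ends of the pattern are carried along the runs, and `b` is the
colour of the points outside of runs. -/
noncomputable def outerColouring (W : ℕ → ℕ) (n L : ℕ) (D : Finset ℕ) (t : ℕ) (c₀ : ℕ → Bool)
    (b : Bool) (x : ℕ) : Bool :=
  if RightRun W n D t x then c₀ L else if LeftRun W n D t x then c₀ 0 else b

/-- The colouring with the pattern `c₀` on the segments of the letter `t`, extended by
`outerColouring` to the other segments. -/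
noncomputable def patternColouring (W : ℕ → ℕ) (n L : ℕ) (D : Finset ℕ) (t : ℕ) (c₀ : ℕ → Bool)
    (b : Bool) (x : ℕ) : Bool :=
  if x / L < n ∧ W (x / L) = t then c₀ (x % L) else outerColouring W n L D t c₀ b (x / L)

section Colourings

variable {W : ℕ → ℕ} {n k L : ℕ} {D : Finset ℕ} {K : Finset (SetRel ℕ ℕ)}

theorem isLinked_of_mem_wordSegment (hL : 0 < L) {p i x y : ℕ} (hiD : W i ∈ D)
    (hx : x ∈ wordSegment L i) (hy : y ∈ wordSegment L i) (h : IsLinked W L D p x) :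
    IsLinked W L D p y := by
  obtain ⟨hx, hx'⟩ := hx
  obtain ⟨hy, hy'⟩ := hy
  refine Or.inr fun j hj hj' => ?_
  rcases lt_trichotomy j i with hji | rfl | hji
  · have := mul_add_le_mul L hji
    rcases h with rfl | h
    · omega
    · exact h j (by omega) (by omega)
  · exact hiD
  · have := mul_add_le_mul L hji
    rcases h with rfl | h
    · omega
    · exact h j (by omega) (by omega)

open Classical in
theorem isGoodColouring_isLinked (hL : 0 < L) (n p : ℕ) (K : Finset (SetRel ℕ ℕ)) :
    IsGoodColouring W n L D K fun x => decide (IsLinked W L D p x) := by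
  rintro _ htD
  refine Or.inl fun i _ hit x hx => decide_eq_decide.2 ?_
  subst hit
  exact ⟨isLinked_of_mem_wordSegment hL htD hx (mul_mem_wordSegment L i),
    isLinked_of_mem_wordSegment hL htD (mul_mem_wordSegment L i) hx⟩

section Outer

variable {t i : ℕ} {c₀ : ℕ → Bool} {b : Bool}

theorem outerColouring_of_rightRun (h : RightRun W n D t i) :
    outerColouring W n L D t c₀ b i = c₀ L := if_pos h

theorem outerColouring_of_not_rightRun (h : ¬ RightRun W n D t i) :
    outerColouring W n L D t c₀ (c₀ 0) i = c₀ 0 := by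
  rw [outerColouring, if_neg h, ite_self]

theorem outerColouring_of_not_leftRun (h : ¬ LeftRun W n D t i) :
    outerColouring W n L D t c₀ (c₀ L) i = c₀ L := by
  rw [outerColouring, if_neg h, ite_self]

theorem outerColouring_succ_of_ne (hiD : W i ∈ D) (hit : W i ≠ t) :
    outerColouring W n L D t c₀ b (i + 1) = outerColouring W n L D t c₀ b i := by
  rw [outerColouring, outerColouring, rightRun_succ_iff hiD hit, leftRun_succ_iff hiD hit]

theorem IsScattered.outerColouring_self (hW : IsScattered W n k) (hD : D.card ≤ k) (hi : i < n)
    (hiD : W i ∈ D) : outerColouring W n L D (W i) c₀ b i = c₀ 0 := by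
  rw [outerColouring, if_neg (hW.not_rightRun hD hi hiD), if_pos (leftRun_self hi)]

theorem IsScattered.patternColouring_mul (hW : IsScattered W n k) (hD : D.card ≤ k) (hL : 0 < L)
    (ht : t ∈ D) (i : ℕ) :
    patternColouring W n L D t c₀ b (i * L) = outerColouring W n L D t c₀ b i := by
  rw [patternColouring, Nat.mul_div_cancel _ hL, Nat.mul_mod_left]
  split_ifs with h
  · obtain ⟨hi, rfl⟩ := h
    exact (hW.outerColouring_self hD hi ht).symm
  · rfl

theorem eq_succ_mul_or_div_eq {x : ℕ} (hx : x ∈ wordSegment L i) :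
    x = (i + 1) * L ∨ x / L = i ∧ x % L = x - i * L := by
  rcases hx.2.eq_or_lt with h | h
  · exact Or.inl (h.trans (Nat.succ_mul i L).symm)
  · have hdiv : x / L = i := Nat.div_eq_of_lt_le hx.1 (h.trans_eq (Nat.succ_mul i L).symm)
    exact Or.inr ⟨hdiv, by rw [Nat.mod_eq_sub_div_mul, hdiv]⟩

theorem IsScattered.patternColouring_of_eq (hW : IsScattered W n k) (hD : D.card ≤ k) (hL : 0 < L)
    (ht : t ∈ D) (hi : i < n) (hit : W i = t) {x : ℕ} (hx : x ∈ wordSegment L i) :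
    patternColouring W n L D t c₀ b x = c₀ (x - i * L) := by
  subst hit
  rcases eq_succ_mul_or_div_eq hx with rfl | ⟨hdiv, hmod⟩
  · rw [hW.patternColouring_mul hD hL ht, outerColouring_of_rightRun (rightRun_succ_self hi),
      Nat.succ_mul, Nat.add_sub_cancel_left]
  · rw [patternColouring, hdiv, hmod, if_pos ⟨hi, rfl⟩]

theorem IsScattered.patternColouring_of_ne (hW : IsScattered W n k) (hD : D.card ≤ k) (hL : 0 < L)
    (ht : t ∈ D) (hiD : W i ∈ D) (hit : W i ≠ t) {x : ℕ} (hx : x ∈ wordSegment L i) :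
    patternColouring W n L D t c₀ b x = outerColouring W n L D t c₀ b i := by
  rcases eq_succ_mul_or_div_eq hx with rfl | ⟨hdiv, -⟩
  · rw [hW.patternColouring_mul hD hL ht, outerColouring_succ_of_ne hiD hit]
  · rw [patternColouring, hdiv, if_neg fun h => hit h.2]

theorem IsScattered.isGoodColouring_patternColouring (hW : IsScattered W n k) (hD : D.card ≤ k)
    (hL : 0 < L) (ht : t ∈ D) (hc₀ : IsAdmissible c₀ K) (b : Bool) :
    IsGoodColouring W n L D K (patternColouring W n L D t c₀ b) := by
  intro s hs
  rcases eq_or_ne s t with rfl | hst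
  · exact Or.inr ⟨c₀, hc₀, fun i hi his x hx => hW.patternColouring_of_eq hD hL ht hi his hx⟩
  · refine Or.inl fun i _ his x hx => ?_
    subst his
    rw [hW.patternColouring_of_ne hD hL ht hs hst hx, hW.patternColouring_mul hD hL ht]

end Outer

theorem IsScattered.exists_isGoodColouring_ne (hW : IsScattered W n k) (hD : D.card ≤ k)
    (hL : 0 < L)
    (hK : ∀ {x y}, x ≤ L → y ≤ L → x ≠ y → ∃ c, IsAdmissible c K ∧ c x ≠ c y)
    {x y : ℕ} (hxy : x < y) (hy : y ≤ n * L) : ∃ c, IsGoodColouring W n L D K c ∧ c x ≠ c y := by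
  classical
  by_cases hlink : IsLinked W L D x y
  swap
  · exact ⟨_, isGoodColouring_isLinked hL n x K, by simpa [IsLinked] using hlink⟩
  replace hlink := hlink.resolve_left hxy.ne
  rw [max_eq_right hxy.le, min_eq_left hxy.le] at hlink
  obtain ⟨i, hi, hxi, hxi'⟩ := exists_mem_wordSegment_lt hL (hxy.trans_le hy)
  obtain ⟨j, hj, hyj, hyj'⟩ := exists_mem_wordSegment_gt hL (by omega) hy
  have hiD : W i ∈ D := hlink i (hxi.1.trans_lt hxy) hxi'
  have hij : i ≤ j := by
    by_contra h
    have := mul_add_le_mul L (not_le.1 h)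
    have := hxi.1
    have := hyj.2
    omega
  rcases hij.eq_or_lt with rfl | hij
  · obtain ⟨c₀, hc₀, hne⟩ := hK (sub_le_of_mem_wordSegment hxi) (sub_le_of_mem_wordSegment hyj)
      (by have := hxi.1; omega)
    refine ⟨_, hW.isGoodColouring_patternColouring hD hL hiD hc₀ true, ?_⟩
    rwa [hW.patternColouring_of_eq hD hL hiD hi rfl hxi,
      hW.patternColouring_of_eq hD hL hiD hi rfl hyj]
  · have hjD : W j ∈ D := hlink j hyj' (by have := mul_add_le_mul L hij; omega)
    have hrun : RightRun W n D (W i) j := ⟨i, hij, hi, rfl, fun l hil hlj => hlink l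
      (by have := mul_add_le_mul L hlj; omega) (by have := mul_add_le_mul L hil; omega)⟩
    have hji : W j ≠ W i := fun h => hW.not_rightRun hD hj hjD (h ▸ hrun)
    obtain ⟨c₀, hc₀, hne⟩ := hK (sub_le_of_mem_wordSegment hxi) le_rfl (by omega)
    refine ⟨_, hW.isGoodColouring_patternColouring hD hL hiD hc₀ true, ?_⟩
    rwa [hW.patternColouring_of_eq hD hL hiD hi rfl hxi,
      hW.patternColouring_of_ne hD hL hiD hjD hji hyj, outerColouring_of_rightRun hrun]

section Outside

variable {s p l : ℕ}

theorem IsScattered.exists_isGoodColouring_of_lt (hW : IsScattered W n k) (hD : D.card ≤ k)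
    (hL : 0 < L) (hK : ∀ {x y}, x ≤ L → y ≤ L → x ≠ y → ∃ c, IsAdmissible c K ∧ c x ≠ c y)
    (hs : s ∈ D) (hout : ∀ i < n, W i = s → p ∉ wordSegment L i) (hl : l < n) (hls : W l = s)
    (hp : p < l * L) (hlink : ∀ i, i * L < l * L → p < i * L + L → W i ∈ D) :
    ∃ c b, IsGoodColouring W n L D K c ∧ c p ≠ b ∧
      ∀ i < n, W i = s → ∀ x ∈ wordSegment L i, c x = b := by
  obtain ⟨i, hil, hpi, hpi'⟩ := exists_mem_wordSegment_lt hL hp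
  have hi := hil.trans hl
  have hiD : W i ∈ D := hlink i (Nat.mul_lt_mul_of_pos_right hil hL) hpi'
  have his : W i ≠ s := fun h => hout i hi h hpi
  have hrun : RightRun W n D (W i) l := ⟨i, hil, hi, rfl, fun j hij hjl => hlink j
    (Nat.mul_lt_mul_of_pos_right hjl hL) (by have := mul_add_le_mul L hij; omega)⟩
  obtain ⟨c₀, hc₀, hne⟩ := hK (sub_le_of_mem_wordSegment hpi) le_rfl (by omega)
  refine ⟨_, c₀ L, hW.isGoodColouring_patternColouring hD hL hiD hc₀ (c₀ L), ?_, ?_⟩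
  · rwa [hW.patternColouring_of_eq hD hL hiD hi rfl hpi]
  · rintro j hj rfl x hx
    rw [hW.patternColouring_of_ne hD hL hiD hs his.symm hx, outerColouring_of_not_leftRun
      (hW.not_leftRun_of_rightRun hD hl hj hls (hls ▸ hs) hiD hrun)]

theorem IsScattered.exists_isGoodColouring_of_gt (hW : IsScattered W n k) (hD : D.card ≤ k)
    (hL : 0 < L) (hK : ∀ {x y}, x ≤ L → y ≤ L → x ≠ y → ∃ c, IsAdmissible c K ∧ c x ≠ c y)
    (hs : s ∈ D) (hpn : p ≤ n * L) (hout : ∀ i < n, W i = s → p ∉ wordSegment L i) (hl : l < n)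
    (hls : W l = s) (hp : l * L < p) (hlink : ∀ i, i * L < p → l * L < i * L + L → W i ∈ D) :
    ∃ c b, IsGoodColouring W n L D K c ∧ c p ≠ b ∧
      ∀ i < n, W i = s → ∀ x ∈ wordSegment L i, c x = b := by
  obtain ⟨i, hi, hpi, hpi'⟩ := exists_mem_wordSegment_gt hL (by omega) hpn
  have his : W i ≠ s := fun h => hout i hi h hpi
  have hli : l ≤ i := by
    by_contra h
    have := mul_add_le_mul L (not_le.1 h)
    have := hpi.2
    omega
  have hmem : ∀ j, l ≤ j → j ≤ i → W j ∈ D := fun j hlj hji => hlink j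
    ((Nat.mul_le_mul_right L hji).trans_lt hpi') (by have := Nat.mul_le_mul_right L hlj; omega)
  have hiD := hmem i hli le_rfl
  have hrun : LeftRun W n D (W i) l := ⟨i, hli, hi, rfl, fun j hlj hji => hmem j hlj hji.le⟩
  obtain ⟨c₀, hc₀, hne⟩ := hK (sub_le_of_mem_wordSegment hpi) (Nat.zero_le L) (by omega)
  refine ⟨_, c₀ 0, hW.isGoodColouring_patternColouring hD hL hiD hc₀ (c₀ 0), ?_, ?_⟩
  · rwa [hW.patternColouring_of_eq hD hL hiD hi rfl hpi]
  · rintro j hj rfl x hx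
    rw [hW.patternColouring_of_ne hD hL hiD hs his.symm hx, outerColouring_of_not_rightRun
      fun hr => hW.not_leftRun_of_rightRun hD hj hl hls.symm hs hiD hr hrun]

theorem IsScattered.exists_isGoodColouring_eq_ne (hW : IsScattered W n k) (hD : D.card ≤ k)
    (hL : 0 < L) (hK : ∀ {x y}, x ≤ L → y ≤ L → x ≠ y → ∃ c, IsAdmissible c K ∧ c x ≠ c y)
    (hs : s ∈ D) (hpn : p ≤ n * L) (hout : ∀ i < n, W i = s → p ∉ wordSegment L i) :
    ∃ c b, IsGoodColouring W n L D K c ∧ c p ≠ b ∧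
      ∀ i < n, W i = s → ∀ x ∈ wordSegment L i, c x = b := by
  classical
  by_cases h : ∃ l < n, W l = s ∧ IsLinked W L D p (l * L)
  · obtain ⟨l, hl, hls, rfl | hlink⟩ := h
    · exact absurd (mul_mem_wordSegment L l) (hout l hl hls)
    rcases lt_trichotomy p (l * L) with hp | rfl | hp
    · rw [max_eq_right hp.le, min_eq_left hp.le] at hlink
      exact hW.exists_isGoodColouring_of_lt hD hL hK hs hout hl hls hp hlink
    · exact absurd (mul_mem_wordSegment L l) (hout l hl hls)
    · rw [max_eq_left hp.le, min_eq_right hp.le] at hlink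
      exact hW.exists_isGoodColouring_of_gt hD hL hK hs hpn hout hl hls hp hlink
  · refine ⟨_, false, isGoodColouring_isLinked hL n p K, by simp [IsLinked], ?_⟩
    rintro i hi rfl x hx
    exact decide_eq_false fun hlink =>
      h ⟨i, hi, rfl, isLinked_of_mem_wordSegment hL hs hx (mul_mem_wordSegment L i) hlink⟩

end Outside

end Colourings

section Extend

variable {W : ℕ → ℕ} {n k L : ℕ} {T : Set (SetRel ℕ ℕ)} {D : Finset ℕ} {K K' : Finset (SetRel ℕ ℕ)}

theorem exists_eq_liftRel (hK : ↑K ⊆ extendRels W n L T) :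
    ∃ (D : Finset ℕ) (K' : Finset (SetRel ℕ ℕ)), D.card ≤ K.card ∧ K'.card ≤ K.card ∧ ↑K' ⊆ T ∧
      ∀ b ∈ K, b.Subsingleton ∨ ∃ t ∈ D, ∃ a ∈ K', b = liftRel W n L t a := by
  classical
  let K₀ := K.filter fun b => ¬ b.Subsingleton
  have hlift : ∀ b ∈ K₀, ∃ t, ∃ a ∈ T, b = liftRel W n L t a := fun b hb =>
    (hK (Finset.mem_filter.1 hb).1).resolve_left fun h => (Finset.mem_filter.1 hb).2 h.1
  choose! letter rel hrel hlift using hlift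
  have hle : K₀.card ≤ K.card := Finset.card_filter_le _ _
  refine ⟨K₀.image letter, K₀.image rel, Finset.card_image_le.trans hle,
    Finset.card_image_le.trans hle, ?_, fun b hb => or_iff_not_imp_left.2 fun hb' => ?_⟩
  · rintro _ ha
    obtain ⟨b, hb, rfl⟩ := Finset.mem_image.1 ha
    exact hrel b hb
  · have hb : b ∈ K₀ := Finset.mem_filter.2 ⟨hb, hb'⟩
    exact ⟨letter b, Finset.mem_image_of_mem _ hb, rel b, Finset.mem_image_of_mem _ hb, hlift b hb⟩

theorem IsUniform.liftRel {t : ℕ} {a : SetRel ℕ ℕ} {c c₀ : ℕ → Bool} (h : IsUniform c₀ a)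
    (hc : ∀ i < n, W i = t → ∀ x ∈ wordSegment L i, c x = c₀ (x - i * L)) :
    IsUniform c (liftRel W n L t a) := by
  rintro _ ⟨i, hi, hit, hx, hy, hxy⟩ _ ⟨j, hj, hjt, hx', hy', hxy'⟩
  rw [hc i hi hit _ hx, hc i hi hit _ hy, hc j hj hjt _ hx', hc j hj hjt _ hy']
  exact h _ hxy _ hxy'

theorem IsFlat.liftRel {t : ℕ} {a : SetRel ℕ ℕ} {c c₀ : ℕ → Bool} (h : IsFlat c₀ a)
    (hc : ∀ i < n, W i = t → ∀ x ∈ wordSegment L i, c x = c₀ (x - i * L)) :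
    IsFlat c (liftRel W n L t a) := by
  rintro _ ⟨i, hi, hit, hx, hy, hxy⟩
  rw [hc i hi hit _ hx, hc i hi hit _ hy]
  exact h _ hxy

theorem IsGoodColouring.isAdmissible {c : ℕ → Bool} (hc : IsGoodColouring W n L D K' c)
    (hK : ∀ b ∈ K, b.Subsingleton ∨ ∃ t ∈ D, ∃ a ∈ K', b = liftRel W n L t a) :
    IsAdmissible c K := by
  intro b hb
  rcases hK b hb with hsub | ⟨t, ht, a, ha, rfl⟩
  · exact Or.inr (isUniform_of_subsingleton c hsub)
  rcases hc t ht with hconst | ⟨c₀, hc₀, hpattern⟩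
  · left
    rintro _ ⟨i, hi, hit, hx, hy, -⟩
    rw [hconst i hi hit _ hx, hconst i hi hit _ hy]
  · exact (hc₀ a ha).imp (fun h => h.liftRel hpattern) fun h => h.liftRel hpattern

theorem extendRels_points (hW : IsScattered W n k) (hT : IsSeparated L T k)
    (hK : ↑K ⊆ extendRels W n L T) (hKk : K.card ≤ k) {x y : ℕ} (hx : x ≤ n * L) (hy : y ≤ n * L)
    (hxy : x ≠ y) : ∃ c, IsAdmissible c K ∧ c x ≠ c y := by
  wlog hlt : x < y generalizing x y
  · obtain ⟨c, hc, hne⟩ := this hy hx hxy.symm (by omega)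
    exact ⟨c, hc, hne.symm⟩
  obtain ⟨D, K', hD, hK'k, hK', hKD⟩ := exists_eq_liftRel hK
  obtain ⟨c, hc, hne⟩ := hW.exists_isGoodColouring_ne (hD.trans hKk) hT.pos
    (hT.points hK' (hK'k.trans hKk)) hlt hy
  exact ⟨c, hc.isAdmissible hKD, hne⟩

theorem extendRels_dom_of_subsingleton (hW : IsScattered W n k) (hT : IsSeparated L T k)
    (hK : ↑K ⊆ extendRels W n L T) (hKk : K.card ≤ k) {b : SetRel ℕ ℕ} (hbK : b ∈ K)
    (hb : b.Subsingleton) {x : ℕ} (hx : x ≤ n * L) (hxb : x ∉ b.dom) :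
    ∃ c, IsAdmissible c K ∧ ∀ p ∈ b, c p.1 ≠ c x := by
  rcases b.eq_empty_or_nonempty with rfl | ⟨p, hp⟩
  · exact ⟨fun _ => false, fun b _ => Or.inl fun _ _ => rfl, fun p hp => hp.elim⟩
  · have hpx : p.1 ≠ x := fun h => hxb ⟨p.2, h ▸ hp⟩
    obtain ⟨c, hc, hne⟩ := extendRels_points hW hT hK hKk (extendRels_bdd (hK hbK) hp).1 hx hpx
    exact ⟨c, hc, fun q hq => hb hp hq ▸ hne⟩

theorem extendRels_dom (hW : IsScattered W n k) (hT : IsSeparated L T k)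
    (hK : ↑K ⊆ extendRels W n L T) (hKk : K.card ≤ k) {b : SetRel ℕ ℕ} (hb : b ∈ K)
    {x : ℕ} (hx : x ≤ n * L) (hxb : x ∉ b.dom) :
    ∃ c, IsAdmissible c K ∧ IsUniform c b ∧ ∀ p ∈ b, c p.1 ≠ c x := by
  by_cases hsub : b.Subsingleton
  · obtain ⟨c, hc, hne⟩ := extendRels_dom_of_subsingleton hW hT hK hKk hb hsub hx hxb
    exact ⟨c, hc, isUniform_of_subsingleton c hsub, hne⟩
  obtain ⟨D, K', hD, hK'k, hK', hKD⟩ := exists_eq_liftRel hK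
  replace hD := hD.trans hKk
  replace hK'k := hK'k.trans hKk
  obtain ⟨s, hs, a, ha, rfl⟩ := (hKD b hb).resolve_left hsub
  by_cases hin : ∃ i < n, W i = s ∧ x ∈ wordSegment L i
  · obtain ⟨i, hi, his, hxi⟩ := hin
    obtain ⟨c₀, hc₀, hunif, hne⟩ := hT.dom hK' hK'k ha (sub_le_of_mem_wordSegment hxi)
      fun ⟨y, hy⟩ => hxb ⟨i * L + y, i, hi, his, hxi, mem_wordSegment_add i (hT.bdd (hK' ha) hy).2,
        by simpa using hy⟩
    have hpattern : ∀ j < n, W j = s → ∀ z ∈ wordSegment L j,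
        patternColouring W n L D s c₀ true z = c₀ (z - j * L) := fun j hj hjs z hz =>
      hW.patternColouring_of_eq hD hT.pos hs hj hjs hz
    refine ⟨_, (hW.isGoodColouring_patternColouring hD hT.pos hs hc₀ true).isAdmissible hKD,
      hunif.liftRel hpattern, ?_⟩
    rintro _ ⟨j, hj, hjs, hz, -, hzy⟩
    rw [hpattern i hi his x hxi, hpattern j hj hjs _ hz]
    exact hne _ hzy
  · obtain ⟨c, col, hc, hne, hcol⟩ := hW.exists_isGoodColouring_eq_ne hD hT.pos
      (hT.points hK' hK'k) hs hx fun i hi his hxi => hin ⟨i, hi, his, hxi⟩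
    refine ⟨c, hc.isAdmissible hKD, ?_, ?_⟩
    · rintro _ ⟨i, hi, his, hy, hz, -⟩ _ ⟨j, hj, hjs, hy', hz', -⟩
      simp only [hcol i hi his _ hy, hcol i hi his _ hz, hcol j hj hjs _ hy', hcol j hj hjs _ hz',
        and_self]
    · rintro _ ⟨i, hi, his, hy, -⟩
      exact (hcol i hi his _ hy).trans_ne hne.symm

theorem extendRels_isSeparated (hW : IsScattered W n k) (hk : 1 ≤ k) (hn : 0 < n)
    (hT : IsSeparated L T k) : IsSeparated (n * L) (extendRels W n L T) k where
  toIsInjSystem := extendRels_isInjSystem hW hk hT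
  pos := Nat.mul_pos hn hT.pos
  bdd := extendRels_bdd
  points := extendRels_points hW hT
  dom := extendRels_dom hW hT

end Extend

/-! ### Identities of the Brandt monoid in separated systems -/

/-- The least `k` such that all variables of the term are among the first `k` variables. -/
def SemiringTerm.bound : SemiringTerm → ℕ
  | .var i => i + 1
  | .add s t => max s.bound t.bound
  | .mul s t => max s.bound t.bound

/-- The least `k` such that all variables of the identity are among the first `k` variables. -/
def SemiringIdentity.bound (p : SemiringIdentity) : ℕ := max p.lhs.bound p.rhs.bound

namespace BrandtMonoid

/-- The partial injection of two points given by the nonzero entries of a matrix. -/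
def Rel (A : BrandtMonoid) (x y : Fin 2) : Prop := A.1 x y ≠ 0

theorem rel_add {A B : BrandtMonoid} {x y : Fin 2} : (A + B).Rel x y ↔ A.Rel x y ∧ B.Rel x y :=
  mul_ne_zero_iff

theorem rel_mul {A B : BrandtMonoid} {x y : Fin 2} :
    (A * B).Rel x y ↔ ∃ z, A.Rel x z ∧ B.Rel z y := by
  change ∑ z, A.1 x z * B.1 z y ≠ 0 ↔ _
  simp only [ne_eq, Finset.sum_eq_zero_iff, Finset.mem_univ, true_imp_iff, not_forall,
    mul_eq_zero, not_or, Rel]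

theorem Rel.unique {A : BrandtMonoid} {x y z : Fin 2} (h : A.Rel x y) (h' : A.Rel x z) : y = z := by
  have hrow : ∀ A ∈ brandtMatrices, ∀ x, (A x 0 = 0 ∨ A x 1 = 0) := by decide
  by_contra hyz
  obtain ⟨rfl, rfl⟩ | ⟨rfl, rfl⟩ : y = 0 ∧ z = 1 ∨ y = 1 ∧ z = 0 := by omega
  · exact (hrow A.1 A.2 x).elim h h'
  · exact (hrow A.1 A.2 x).elim h' h

/-- The matrix unit with the nonzero entry in the position `(x, y)`. -/
def unit (x y : Fin 2) : BrandtMonoid :=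
  ⟨Matrix.of fun u v => if u = x ∧ v = y then 1 else 0, by revert x y; decide⟩

theorem rel_unit {x y u v : Fin 2} : (unit x y).Rel u v ↔ u = x ∧ v = y := by
  change (if u = x ∧ v = y then 1 else 0) ≠ 0 ↔ _
  simp

/-- The identity matrix. -/
def identity : BrandtMonoid := ⟨1, by decide⟩

theorem rel_identity (u : Fin 2) : identity.Rel u u := by
  change (1 : Matrix (Fin 2) (Fin 2) ℕ) u u ≠ 0
  simp

/-- The zero matrix. -/
def zero : BrandtMonoid := ⟨0, by decide⟩

theorem not_rel_zero (u v : Fin 2) : ¬ zero.Rel u v := fun h => h rfl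

/-- A colour as an index of the rows and columns of a matrix. -/
def point (b : Bool) : Fin 2 := if b then 1 else 0

theorem point_injective : Function.Injective point := by decide

section Image

variable {α : Type*}

open Classical in
/-- The matrix assigned to a relation by a two-colouring: the zero matrix or a matrix unit if the
relation is uniform, the identity matrix otherwise. -/
noncomputable def image (c : α → Bool) (a : SetRel α α) : BrandtMonoid :=
  if IsUniform c a then
    if h : a.Nonempty then unit (point (c h.some.1)) (point (c h.some.2)) else zero
  else identity

theorem rel_image_of_mem {c : α → Bool} {a : SetRel α α} (ha : IsFlat c a ∨ IsUniform c a)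
    {x y : α} (h : x ~[a] y) : (image c a).Rel (point (c x)) (point (c y)) := by
  by_cases hu : IsUniform c a
  · have hne : a.Nonempty := ⟨_, h⟩
    obtain ⟨hx, hy⟩ := hu _ h _ hne.some_mem
    rw [image, if_pos hu, dif_pos hne, rel_unit, ← hx, ← hy]
    exact ⟨rfl, rfl⟩
  · have hxy : c x = c y := ha.resolve_right hu _ h
    rw [image, if_neg hu, hxy]
    exact rel_identity _

theorem exists_mem_of_rel_image {c : α → Bool} {a : SetRel α α} (ha : IsUniform c a)
    {x y : Fin 2} (h : (image c a).Rel x y) : ∃ p ∈ a, x = point (c p.1) := by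
  rw [image, if_pos ha] at h
  split_ifs at h with hne
  · exact ⟨hne.some, hne.some_mem, (rel_unit.1 h).1⟩
  · exact absurd h (not_rel_zero _ _)

end Image

end BrandtMonoid

namespace IsInjSystem

variable {α : Type*} {T : Set (SetRel α α)} {hT : IsInjSystem T} {τ : ℕ → hT.Carrier} {k : ℕ}
  {c : α → Bool}

open Classical in
/-- The relations assigned to the first `k` variables. -/
noncomputable def assignedRels (τ : ℕ → hT.Carrier) (k : ℕ) : Finset (SetRel α α) :=
  (Finset.range k).image fun i => (τ i).1

theorem mem_assignedRels {i : ℕ} (hi : i < k) : (τ i).1 ∈ assignedRels τ k := by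
  classical exact Finset.mem_image_of_mem (fun i => (τ i).1) (Finset.mem_range.2 hi)

theorem assignedRels_subset : ↑(assignedRels τ k) ⊆ T := by
  classical
  intro a ha
  obtain ⟨i, -, rfl⟩ := Finset.mem_image.1 ha
  exact (τ i).2

theorem card_assignedRels_le : (assignedRels τ k).card ≤ k := by
  classical exact Finset.card_image_le.trans (Finset.card_range k).le

/-- The matrices assigned to the variables by a two-colouring. -/
noncomputable def matrices (τ : ℕ → hT.Carrier) (c : α → Bool) (i : ℕ) : BrandtMonoid :=
  BrandtMonoid.image c (τ i).1

theorem rel_eval (hc : IsAdmissible c (assignedRels τ k)) {t : SemiringTerm} (ht : t.bound ≤ k)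
    {x y : α} (hxy : x ~[(t.eval τ).1] y) :
    (t.eval (matrices τ c)).Rel (BrandtMonoid.point (c x)) (BrandtMonoid.point (c y)) := by
  induction t generalizing x y with
  | var i => exact BrandtMonoid.rel_image_of_mem (hc _ (mem_assignedRels ht)) hxy
  | add s t ihs iht =>
    obtain ⟨hs, ht⟩ := max_le_iff.1 ht
    exact BrandtMonoid.rel_add.2 ⟨ihs hs hxy.1, iht ht hxy.2⟩
  | mul s t ihs iht =>
    obtain ⟨hs, ht⟩ := max_le_iff.1 ht
    obtain ⟨z, hxz, hzy⟩ := hxy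
    exact BrandtMonoid.rel_mul.2 ⟨_, ihs hs hxz, iht ht hzy⟩

end IsInjSystem

namespace IsSeparated

open IsInjSystem

variable {L k : ℕ} {T : Set (SetRel ℕ ℕ)} {x y z : ℕ} {s t : SemiringTerm}

/-- Since matrices in the Brandt monoid are partial functions, colouring the two images of `x`
differently keeps the values of the two terms apart. -/
theorem exists_separating_of_images_ne (hT : IsSeparated L T k) (τ : ℕ → hT.Carrier)
    (hs : s.bound ≤ k) (ht : t.bound ≤ k) (hy : x ~[(s.eval τ).1] y) (hz : x ~[(t.eval τ).1] z)
    (hyz : y ≠ z) : ∃ c, IsAdmissible c (assignedRels τ k) ∧ ∀ u,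
      ¬ ((s.eval (matrices τ c)).Rel (BrandtMonoid.point (c x)) u ∧
        (t.eval (matrices τ c)).Rel (BrandtMonoid.point (c x)) u) := by
  obtain ⟨c, hc, hne⟩ := hT.points assignedRels_subset card_assignedRels_le
    (hT.bdd (s.eval τ).2 hy).2 (hT.bdd (t.eval τ).2 hz).2 hyz
  exact ⟨c, hc, fun u ⟨hsu, htu⟩ => hne <| BrandtMonoid.point_injective <|
    ((rel_eval hc hs hy).unique hsu).trans ((rel_eval hc ht hz).unique htu).symm⟩

theorem exists_not_rel_eval (hT : IsSeparated L T k) (τ : ℕ → hT.Carrier) (ht : t.bound ≤ k)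
    (hx : x ≤ L) (hxt : x ∉ SetRel.dom (t.eval τ).1) :
    ∃ c, IsAdmissible c (assignedRels τ k) ∧
      ∀ u, ¬ (t.eval (matrices τ c)).Rel (BrandtMonoid.point (c x)) u := by
  induction t generalizing x with
  | var i =>
    obtain ⟨c, hc, hu, hne⟩ :=
      hT.dom assignedRels_subset card_assignedRels_le (mem_assignedRels ht) hx hxt
    refine ⟨c, hc, fun u hxu => ?_⟩
    obtain ⟨p, hp, hxp⟩ := BrandtMonoid.exists_mem_of_rel_image hu hxu
    exact hne p hp (BrandtMonoid.point_injective hxp).symm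
  | add s t ihs iht =>
    obtain ⟨hs, ht⟩ := max_le_iff.1 ht
    by_cases hxs : x ∈ SetRel.dom (s.eval τ).1
    · by_cases hxt' : x ∈ SetRel.dom (t.eval τ).1
      · obtain ⟨y, hy⟩ := hxs
        obtain ⟨z, hz⟩ := hxt'
        obtain ⟨c, hc, hsep⟩ := hT.exists_separating_of_images_ne τ hs ht hy hz
          (by rintro rfl; exact hxt ⟨y, hy, hz⟩)
        exact ⟨c, hc, fun u hu => hsep u (BrandtMonoid.rel_add.1 hu)⟩
      · obtain ⟨c, hc, hsep⟩ := iht ht hx hxt'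
        exact ⟨c, hc, fun u hu => hsep u (BrandtMonoid.rel_add.1 hu).2⟩
    · obtain ⟨c, hc, hsep⟩ := ihs hs hx hxs
      exact ⟨c, hc, fun u hu => hsep u (BrandtMonoid.rel_add.1 hu).1⟩
  | mul s t ihs iht =>
    obtain ⟨hs, ht⟩ := max_le_iff.1 ht
    by_cases hxs : x ∈ SetRel.dom (s.eval τ).1
    · obtain ⟨y, hy⟩ := hxs
      obtain ⟨c, hc, hsep⟩ := iht ht (hT.bdd (s.eval τ).2 hy).2
        fun ⟨z, hz⟩ => hxt ⟨z, y, hy, hz⟩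
      refine ⟨c, hc, fun u hu => ?_⟩
      obtain ⟨w, hw, hwu⟩ := BrandtMonoid.rel_mul.1 hu
      rw [← (rel_eval hc hs hy).unique hw] at hwu
      exact hsep u hwu
    · obtain ⟨c, hc, hsep⟩ := ihs hs hx hxs
      refine ⟨c, hc, fun u hu => ?_⟩
      obtain ⟨w, hw, -⟩ := BrandtMonoid.rel_mul.1 hu
      exact hsep w hw

theorem eval_subset_eval (hT : IsSeparated L T k) (hs : s.bound ≤ k) (ht : t.bound ≤ k)
    (hst : ∀ σ : ℕ → BrandtMonoid, s.eval σ = t.eval σ) (τ : ℕ → hT.Carrier) :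
    (s.eval τ).1 ⊆ (t.eval τ).1 := by
  rintro ⟨x, y⟩ hxy
  by_contra hxyt
  by_cases hxt : x ∈ SetRel.dom (t.eval τ).1
  · obtain ⟨z, hxz⟩ := hxt
    obtain ⟨c, hc, hsep⟩ := hT.exists_separating_of_images_ne τ hs ht hxy hxz
      (by rintro rfl; exact hxyt hxz)
    have hrel := rel_eval hc hs hxy
    exact hsep _ ⟨hrel, hst (matrices τ c) ▸ hrel⟩
  · obtain ⟨c, hc, hsep⟩ := hT.exists_not_rel_eval τ ht (hT.bdd (s.eval τ).2 hxy).1 hxt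
    exact hsep _ (hst (matrices τ c) ▸ rel_eval hc hs hxy)

theorem holdsIn (hT : IsSeparated L T k) {p : SemiringIdentity} (hk : p.bound ≤ k)
    (hp : p.HoldsIn BrandtMonoid) : p.HoldsIn hT.Carrier := fun τ =>
  have ⟨hl, hr⟩ := max_le_iff.1 hk
  Subtype.ext <| (hT.eval_subset_eval hl hr hp τ).antisymm
    (hT.eval_subset_eval hr hl (fun σ => (hp σ).symm) τ)

end IsSeparated

/-! ### Nested words -/

/-- The identity `t = t * t`. -/
def SemiringTerm.idempotencyIdentity (t : SemiringTerm) : SemiringIdentity := ⟨t, .mul t t⟩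

/-- The product of the terms `f 0, …, f m`. -/
def prodTerm (f : ℕ → SemiringTerm) : ℕ → SemiringTerm
  | 0 => f 0
  | m + 1 => .mul (prodTerm f m) (f (m + 1))

/-- The word obtained from a single letter by `h` times substituting, for the letters of
`W 0 ⋯ W m`, copies of the previous word in disjoint sets of variables, one for each letter. The
variables are renamed according to `g`. -/
def nestedWord (W : ℕ → ℕ) (m : ℕ) : ℕ → (ℕ → ℕ) → SemiringTerm
  | 0, g => .var (g 0)
  | h + 1, g => prodTerm (fun i => nestedWord W m h fun x => g (Nat.pair (W i) x)) m

/-- A system of partial injections of `{0, …, n ^ h}` containing the action of each letter of the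
`h`-th nested word over `W 0 ⋯ W (n - 1)`. -/
def nestedRels (W : ℕ → ℕ) (n : ℕ) : ℕ → Set (SetRel ℕ ℕ)
  | 0 => smallRels 1
  | h + 1 => extendRels W n (n ^ h) (nestedRels W n h)

/-- The action of a letter `x` of the `h`-th nested word over `W 0 ⋯ W (n - 1)`: it moves each
position of `x` in that word one step forward. -/
def nestedLetter (W : ℕ → ℕ) (n : ℕ) : ℕ → ℕ → SetRel ℕ ℕ
  | 0, _ => {(0, 1)}
  | h + 1, x => liftRel W n (n ^ h) x.unpair.1 (nestedLetter W n h x.unpair.2)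

section NestedWords

variable {W : ℕ → ℕ} {n m k : ℕ}

theorem nestedRels_isSeparated (hW : IsScattered W n k) (hk : 1 ≤ k) (hn : 0 < n) :
    ∀ h, IsSeparated (n ^ h) (nestedRels W n h) k
  | 0 => smallRels_isSeparated one_pos k
  | h + 1 => by
    rw [pow_succ']
    exact extendRels_isSeparated hW hk hn (nestedRels_isSeparated hW hk hn h)

theorem nestedLetter_mem (W : ℕ → ℕ) (n : ℕ) : ∀ h x, nestedLetter W n h x ∈ nestedRels W n h
  | 0, _ => ⟨Set.subsingleton_singleton, fun x y h => by
      obtain ⟨rfl, rfl⟩ := Prod.ext_iff.1 h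
      exact ⟨zero_le_one, le_rfl⟩⟩
  | h + 1, x => Or.inr ⟨_, _, nestedLetter_mem W n h _, rfl⟩

theorem nestedLetter_bdd : ∀ {h x u v : ℕ}, u ~[nestedLetter W n h x] v → u ≤ n ^ h ∧ v ≤ n ^ h
  | 0, x, _, _, huv => (nestedLetter_mem W n 0 x).2 _ _ huv
  | h + 1, x, _, _, huv => by
    rw [pow_succ']
    exact extendRels_bdd (nestedLetter_mem W n (h + 1) x) huv

theorem nestedLetter_succ_mem {h i x u v : ℕ} (hi : i < n) (huv : u ~[nestedLetter W n h x] v) :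
    (i * n ^ h + u) ~[nestedLetter W n (h + 1) (Nat.pair (W i) x)] (i * n ^ h + v) := by
  rw [nestedLetter, Nat.unpair_pair]
  exact liftRel_mem hi (nestedLetter_bdd huv).1 (nestedLetter_bdd huv).2 huv

section Evaluation

variable {T : Set (SetRel ℕ ℕ)} {hT : IsInjSystem T} {τ : ℕ → hT.Carrier}

theorem mem_eval_prodTerm {f : ℕ → SemiringTerm} {d l : ℕ}
    (hf : ∀ i ≤ m, (d + i * l) ~[((f i).eval τ).1] (d + (i + 1) * l)) :
    d ~[((prodTerm f m).eval τ).1] (d + (m + 1) * l) := by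
  induction m with
  | zero =>
    have hf0 := hf 0 le_rfl
    rwa [zero_mul, add_zero] at hf0
  | succ m ih => exact ⟨_, ih fun i hi => hf i (by omega), hf (m + 1) le_rfl⟩

theorem mem_eval_nestedWord {h d : ℕ} {g : ℕ → ℕ}
    (hd : ∀ x u v, u ~[nestedLetter W (m + 1) h x] v → (d + u) ~[(τ (g x)).1] (d + v)) :
    d ~[((nestedWord W m h g).eval τ).1] (d + (m + 1) ^ h) := by
  induction h generalizing d g with
  | zero => exact hd 0 0 1 rfl
  | succ h ih =>
    rw [pow_succ']
    refine mem_eval_prodTerm fun i hi => ?_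
    rw [add_mul, one_mul, ← add_assoc]
    refine ih fun x u v huv => ?_
    rw [add_assoc, add_assoc]
    exact hd _ _ _ (nestedLetter_succ_mem (Nat.lt_succ_of_le hi) huv)

end Evaluation

theorem not_holdsIn_idempotencyIdentity_nestedWord (hW : IsScattered W (m + 1) k) (hk : 1 ≤ k)
    (h : ℕ) : ¬ (nestedWord W m h id).idempotencyIdentity.HoldsIn
      (nestedRels_isSeparated hW hk m.succ_pos h).Carrier := by
  intro hidem
  have hT := nestedRels_isSeparated hW hk m.succ_pos h
  let τ : ℕ → hT.Carrier := fun x => ⟨_, nestedLetter_mem W (m + 1) h x⟩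
  have hidem : (nestedWord W m h id).eval τ =
      (nestedWord W m h id).eval τ * (nestedWord W m h id).eval τ := hidem τ
  have hword : 0 ~[((nestedWord W m h id).eval τ).1] (0 + (m + 1) ^ h) :=
    mem_eval_nestedWord fun x u v huv => by
      rw [zero_add, zero_add]
      exact huv
  have hsq := hword
  rw [hidem] at hsq
  obtain ⟨z, h0z, hz⟩ := hsq
  have hinj := hT.inj ((nestedWord W m h id).eval τ).2
  obtain rfl := hinj.2 h0z hword
  rw [zero_add] at hword hz
  exact hT.pos.ne (hinj.1 hword hz)

end NestedWords

/-! ### Adjoining a neutral element -/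

section WithOne

variable {S : Type u} [Semigroup S]

theorem IsBlockGroup.withOne (hb : IsBlockGroup S) : IsBlockGroup (WithOne S) := by
  constructor
  · intro e f hef he hfe hf
    cases e with
    | one => rw [← hef, one_mul]
    | coe e =>
      cases f with
      | one => rwa [one_mul] at hfe
      | coe f =>
        norm_cast at *
        exact hb.1 e f hef he hfe hf
  · intro e f hef hf hfe he
    cases e with
    | one => rw [← hfe, mul_one]
    | coe e =>
      cases f with
      | one => rwa [mul_one] at hef
      | coe f =>
        norm_cast at *
        exact hb.2 e f hef hf hfe he

theorem eq_one_of_mul_eq_one_withOne {x y : WithOne S} (h : x * y = 1) : x = 1 := by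
  by_contra hx
  lift x to S using hx
  cases y with
  | one => exact WithOne.coe_ne_one (h ▸ mul_one _).symm
  | coe y => exact WithOne.coe_ne_one h

theorem HasSolvableSubgroups.isSolvable_of_injective (hs : HasSolvableSubgroups S) {G : Type u}
    [Group G] {f : G →ₙ* S} (hf : Function.Injective f) : Group.IsSolvable G :=
  hs f.srange G ⟨MulEquiv.ofBijective f.srangeRestrict
    ⟨fun _ _ h => hf (congrArg Subtype.val h), f.srangeRestrict_surjective⟩⟩

/-- A subgroup of `WithOne S` is trivial if it contains the adjoined element, and otherwise it is
a subgroup of `S`. -/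
theorem HasSolvableSubgroups.withOne (hs : HasSolvableSubgroups S) :
    HasSolvableSubgroups (WithOne S) := by
  rintro H G _ ⟨φ⟩
  have hφ : Function.Injective fun g => (φ g : WithOne S) := Subtype.val_injective.comp φ.injective
  by_cases hone : ∃ g, (φ g : WithOne S) = 1
  · obtain ⟨g, hg⟩ := hone
    have hall : ∀ x, (φ x : WithOne S) = 1 := fun x => eq_one_of_mul_eq_one_withOne
      (y := φ (x⁻¹ * g)) (by rw [← MulMemClass.coe_mul, ← map_mul, mul_inv_cancel_left, hg])
    have : Subsingleton G := ⟨fun x y => hφ ((hall x).trans (hall y).symm)⟩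
    infer_instance
  · push Not at hone
    choose f hf using fun g => WithOne.ne_one_iff_exists.1 (hone g)
    let F : G →ₙ* S := ⟨f, fun x y => WithOne.coe_injective <| by
      rw [WithOne.coe_mul, hf, hf, hf, map_mul, MulMemClass.coe_mul]⟩
    have hF : Function.Injective F := fun x y h => hφ <|
      (hf x).symm.trans ((congrArg WithOne.coe h).trans (hf y))
    exact hs.isSolvable_of_injective hF

end WithOne

/-! ### Values of nested words and the main theorem -/

section Values

variable {S : Type u} [AISemiring S] {W : ℕ → ℕ} {m : ℕ}

theorem coe_eval_prodTerm (τ : ℕ → S) (f : ℕ → SemiringTerm) (m : ℕ) :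
    (((prodTerm f m).eval τ : S) : WithOne S) =
      seqProd (fun i => (((f i).eval τ : S) : WithOne S)) (m + 1) := by
  induction m with
  | zero => rw [seqProd_succ, seqProd_zero, one_mul, prodTerm]
  | succ m ih =>
    rw [seqProd_succ, ← ih]
    rfl

theorem coe_eval_nestedWord_mem (W : ℕ → ℕ) (m : ℕ) (τ : ℕ → S) (h : ℕ) (g : ℕ → ℕ) :
    (((nestedWord W m h g).eval τ : S) : WithOne S) ∈ (wordValues W (m + 1))^[h] Set.univ := by
  induction h generalizing g with
  | zero => trivial
  | succ h ih =>
    rw [Function.iterate_succ_apply']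
    exact ⟨fun t => ((nestedWord W m h fun x => g (Nat.pair t x)).eval τ : S), fun t => ih _,
      (coe_eval_prodTerm τ _ m).symm⟩

theorem exists_iterate_wordValues_subset (S : Type*) [Monoid S] [Finite S] (W : ℕ → ℕ) (n : ℕ) :
    ∃ h, (wordValues (S := S) W n)^[h] Set.univ ⊆
      wordValues W n ((wordValues W n)^[h] Set.univ) := by
  have hanti := (wordValues_mono (S := S) W n).antitone_iterate_of_map_le
    (Set.subset_univ (wordValues W n Set.univ))
  obtain ⟨h, hh⟩ := WellFoundedLT.antitone_chain_condition hanti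
  refine ⟨h, ?_⟩
  rw [← Function.iterate_succ_apply' (wordValues W n)]
  exact (hh (h + 1) h.le_succ).le

theorem exists_idempotencyIdentity_nestedWord_mem_identitiesOf [Finite S]
    (hblock : IsBlockGroup S) (hsolv : HasSolvableSubgroups S) {M N : ℕ} (hM : 2 ≤ M)
    (hcard : Nat.card (WithOne S) ≤ M) (hpow : ∀ x : WithOne S, IsIdempotentElem (x ^ M))
    (hW : IsBlockWord W M N) (hm : M * N = m + 1) :
    ∃ h, (nestedWord W m h id).idempotencyIdentity ∈ identitiesOf S := by
  have : Finite (WithOne S) := inferInstanceAs (Finite (Option S))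
  obtain ⟨h, hh⟩ := exists_iterate_wordValues_subset (WithOne S) W (m + 1)
  refine ⟨h, fun τ => WithOne.coe_injective (Eq.symm ?_)⟩
  rw [← hm] at hh
  exact hblock.withOne.isIdempotentElem_of_subset_wordValues hsolv.withOne hM hcard hpow hW hh _
    (hm ▸ coe_eval_nestedWord_mem W m τ h id)

end Values

theorem mainTheorem4_general {S : Type u} [AISemiring S] [Finite S] (hblock : IsBlockGroup S)
    (hsolv : HasSolvableSubgroups S) (hid : ∀ p ∈ identitiesOf S, p.HoldsIn BrandtMonoid)
    {B : Set SemiringIdentity} {k : ℕ} (hB : ∀ p ∈ B, p.bound ≤ k) : ¬ IsIdentityBasis B S := by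
  rintro ⟨hBS, hbasis⟩
  have : Finite (WithOne S) := inferInstanceAs (Finite (Option S))
  obtain ⟨M, hM, hpow⟩ :=
    exists_le_forall_isIdempotentElem_pow (WithOne S) (max 2 (Nat.card (WithOne S)))
  obtain ⟨hM2, hcard⟩ := max_le_iff.1 hM
  obtain ⟨W, N, hN, hblockWord, hscat⟩ := exists_isBlockWord_isScattered M (k + 1)
  obtain ⟨m, hm⟩ := Nat.exists_eq_succ_of_ne_zero (Nat.mul_pos (by omega : 0 < M) hN).ne'
  rw [hm] at hscat
  obtain ⟨h, hmem⟩ := exists_idempotencyIdentity_nestedWord_mem_identitiesOf hblock hsolv hM2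
    hcard hpow hblockWord hm
  have hk : 1 ≤ k + 1 := Nat.le_add_left 1 k
  have hT := nestedRels_isSeparated hscat hk m.succ_pos h
  exact not_holdsIn_idempotencyIdentity_nestedWord hscat hk h <| hbasis _ hmem hT.Carrier
    fun p hp => hT.holdsIn ((hB p hp).trans k.le_succ) (hid p (hBS hp))

theorem mainTheorem4 {S : Type u} [AISemiring S] [Finite S]
    (hblock : IsBlockGroup S) (hsolv : HasSolvableSubgroups S)
    (hid : ∀ p ∈ identitiesOf S, p.HoldsIn BrandtMonoid) :
    ¬ HasFiniteIdentityBasis S := fun ⟨_, hfin, hB⟩ =>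
  have ⟨_, hk⟩ := (hfin.image SemiringIdentity.bound).bddAbove
  mainTheorem4_general hblock hsolv hid (fun _ hp => hk (Set.mem_image_of_mem _ hp)) hB
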